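/- Fix a field $k$. All simplicial complexes are finite, abstract, and contain the empty face. The link of a face $F$ of $\Delta$ is $\mathrm{link}_\Delta(F)=\{G\setminus F: F\subseteq G\in\Delta\}$. A complex $\Delta$ is a \emph{homology sphere} if for every $F\in\Delta$ the reduced simplicial homology $\widetilde H_i(\mathrm{link}_\Delta(F);k)$ is $k$ for $i=\dim \mathrm{link}_\Delta(F)$ and $0$ for all other $i$. A complex $\Delta$ is a \emph{homology ball} with boundary $\partial\Delta$ if $\partial\Delta$ is a subcomplex of $\Delta$ which is a homology sphere of dimension $\dim\Delta-1$, and for every $F\in\Delta$ the group $\widetilde H_i(\mathrm{link}_\Delta(F);k)$ is $k$ if $F\notin\partial\Delta$ and $i=\dim\mathrm{link}_\Delta(F)$, and $0$ otherwise. A complex is \emph{flag} if every set of its vertices which are pairwise joined by edges is a face. A subcomplex $\Gamma$ of $\Delta$ is \emph{induced} if it contains every face of $\Delta$ all of whose vertices belong to $\Gamma$. The $h$-polynomial of an $(n-1)$-dimensional complex with $f_{i-1}$ faces of cardinality $i$ is $h(\Delta,x)=\sum_{i=0}^n f_{i-1}x^i(1-x)^{n-i}$, and $\theta(\Delta,x)=h(\Delta,x)-h(\partial\Delta,x)$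 for a homology ball $\Delta$. A polynomial $p\in\mathbb R[x]$ is \emph{$\gamma$-positive} with center of symmetry $n/2$ if $p(x)=\sum_{i=0}^{\lfloor n/2\rfloor}\gamma_i x^i(1+x)^{n-2i}$ for some nonnegative reals $\gamma_i$. The \emph{$\gamma$-polynomial} of an $(n-1)$-dimensional homology sphere $\Delta$ is $\gamma(\Delta,x)=\sum_{i=0}^{\lfloor n/2\rfloor}\gamma_i x^i$, where $h(\Delta,x)=\sum_{i=0}^{\lfloor n/2\rfloor}\gamma_i x^i(1+x)^{n-2i}$. Inequalities between polynomials are coefficientwise. For every positive integer $n$ the following statements are equivalent: (i) $\theta(\Delta,x)$ is $\gamma$-positive, with center of symmetry $n/2$, for every $(n-1)$-dimensional flag homology ball $\Delta$ such that $\partial\Delta$ is an induced subcomplex of $\Delta$; (ii) $\gamma(\Delta,x)\ge\gamma(\mathrm{link}_\Delta(v),x)$ for every $(n-1)$-dimensional flag homology sphere $\Delta$ and every vertex $v$ of $\Delta$; (iii) $\gamma(\Delta,x)\ge\gamma(\Gamma,x)$ for every $(n-1)$-dimensional flag homology sphere $\Delta$ and every $(n-2)$-dimensional flag homology sphere $\Gamma$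 which is an induced subcomplex of $\Delta$. -/

import Mathlib

universe u

open Polynomial

set_option maxSynthPendingDepth 3

/-- A finite abstract simplicial complex on a ground set `V`: a finite family of finite subsets of
`V`, closed under passing to subsets. As usual for face enumeration and for reduced homology, the
empty set is a face of every complex (so `{∅}` is the complex of dimension `-1`). Elements of `V`
need not be vertices. -/
@[ext]
structure FiniteComplex (V : Type*) where
  faces : Finset (Finset V)
  empty_mem : ∅ ∈ faces
  down_closed : ∀ {F G : Finset V}, G ∈ faces → F ⊆ G → F ∈ faces

namespace FiniteComplex

section Basic

variable {V : Type*} [DecidableEq V]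

/-- `rank Δ = dim Δ + 1`, the largest cardinality of a face. -/
def rank (Δ : FiniteComplex V) : ℕ := Δ.faces.sup Finset.card

/-- The dimension of a complex; it is `-1` for the complex `{∅}`. -/
def dim (Δ : FiniteComplex V) : ℤ := (Δ.rank : ℤ) - 1

/-- The link of a face `F`: all faces `G` disjoint from `F` such that `F ∪ G` is a face. -/
def link (Δ : FiniteComplex V) (F : Finset V) (hF : F ∈ Δ.faces) : FiniteComplex V where
  faces := Δ.faces.filter (fun G => Disjoint F G ∧ F ∪ G ∈ Δ.faces)
  empty_mem := by simp [Δ.empty_mem, hF]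
  down_closed := by
    intro G H hH hGH
    simp only [Finset.mem_filter] at hH ⊢
    exact ⟨Δ.down_closed hH.1 hGH, Finset.disjoint_of_subset_right hGH hH.2.1,
      Δ.down_closed hH.2.2 (Finset.union_subset_union_right hGH)⟩

/-- A complex is flag if every set of vertices that are pairwise joined by edges is a face. -/
def IsFlag (Δ : FiniteComplex V) : Prop :=
  ∀ F : Finset V, (∀ u ∈ F, ∀ v ∈ F, ({u, v} : Finset V) ∈ Δ.faces) → F ∈ Δ.faces

/-- `Γ` is an induced subcomplex of `Δ`: it is a subcomplex, and it contains every face of `Δ` all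
of whose vertices are vertices of `Γ`. -/
def IsInducedSubcomplex (Γ Δ : FiniteComplex V) : Prop :=
  Γ.faces ⊆ Δ.faces ∧
    ∀ F ∈ Δ.faces, (∀ v ∈ F, ({v} : Finset V) ∈ Γ.faces) → F ∈ Γ.faces

/-- `Δ.faceCount i` is the number of faces with `i` elements, that is, `f_{i-1}(Δ)`. -/
def faceCount (Δ : FiniteComplex V) (i : ℕ) : ℕ := (Δ.faces.filter (fun F => F.card = i)).card

/-- The `h`-polynomial `∑_{i=0}^{n} f_{i-1}(Δ) x^i (1-x)^{n-i}`, where `n = dim Δ + 1`. -/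
noncomputable def hPoly (Δ : FiniteComplex V) : ℝ[X] :=
  ∑ i ∈ Finset.range (Δ.rank + 1), C (Δ.faceCount i : ℝ) * X ^ i * (1 - X) ^ (Δ.rank - i)

/-- The theta polynomial `h(Δ, x) - h(∂Δ, x)` of a homology ball `Δ` with boundary `B = ∂Δ`. -/
noncomputable def thetaPoly (Δ B : FiniteComplex V) : ℝ[X] := Δ.hPoly - B.hPoly

end Basic

section Homology

variable {V : Type*} [LinearOrder V] (k : Type*) [Field k]

/-- The simplicial boundary operator
`[v_0 < ⋯ < v_m] ↦ ∑_j (-1)^j [v_0, …, v_{j-1}, v_{j+1}, …, v_m]`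
on formal `k`-linear combinations of finite subsets of `V`. Subsets are oriented by the linear
order of `V`; the position `j` of `v` in `F` is the number of elements of `F` below `v`. -/
noncomputable def boundary : (Finset V →₀ k) →ₗ[k] (Finset V →₀ k) :=
  Finsupp.linearCombination k fun F : Finset V =>
    ∑ v ∈ F, ((-1 : k) ^ (F.filter (fun w => w < v)).card) • Finsupp.single (F.erase v) (1 : k)

/-- The boundary operator squares to zero. -/
theorem boundary_boundary (c : Finset V →₀ k) : boundary k (boundary k c) = 0 := by
  unfold boundary
  induction c using Finsupp.induction_linear with
  | zero => simp
  | add f g hf hg => simp only [map_add, hf, hg, add_zero]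
  | single F a =>
    simp only [Finsupp.linearCombination_single, map_smul, map_sum, one_smul, Finset.smul_sum]
    simp only [← Finset.smul_sum]
    convert smul_zero a
    simp only [Finset.smul_sum]
    rw [Finset.sum_sigma']
    have key : ∀ v ∈ F, ∀ w ∈ F, v < w →
        (-1 : k) ^ (F.filter (fun x => x < v)).card *
            (-1) ^ ((F.erase v).filter (fun x => x < w)).card +
          (-1 : k) ^ (F.filter (fun x => x < w)).card *
            (-1) ^ ((F.erase w).filter (fun x => x < v)).card = 0 := by
      intro v hv w hw h
      have h1 : (F.erase w).filter (fun x => x < v) = F.filter (fun x => x < v) := by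
        ext x; simp only [Finset.mem_filter, Finset.mem_erase]
        exact ⟨fun hx => ⟨hx.1.2, hx.2⟩, fun hx => ⟨⟨(hx.2.trans h).ne, hx.1⟩, hx.2⟩⟩
      have h2 : (F.erase v).filter (fun x => x < w) = (F.filter (fun x => x < w)).erase v := by
        rw [Finset.filter_erase]
      have h3 : (F.filter (fun x => x < w)).card
          = ((F.filter (fun x => x < w)).erase v).card + 1 :=
        (Finset.card_erase_add_one (by simp [hv, h])).symm
      rw [h1, h2, h3]; ring
    refine Finset.sum_involution (fun p _ => ⟨p.2, p.1⟩) ?_ ?_ ?_ ?_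
    · rintro ⟨v, w⟩ h
      simp only [Finset.mem_sigma, Finset.mem_erase] at h
      obtain ⟨hv, hwv, hw⟩ := h
      simp only [smul_smul]
      rw [Finset.erase_right_comm (a := w), ← add_smul]
      rcases lt_or_gt_of_ne hwv with h | h
      · rw [add_comm, key w hw v hv h, zero_smul]
      · rw [key v hv w hw h, zero_smul]
    · rintro ⟨v, w⟩ h _ h'
      simp only [Finset.mem_sigma, Finset.mem_erase] at h
      simp only [Sigma.mk.injEq] at h'
      exact h.2.1 h'.1
    · rintro ⟨v, w⟩ h
      simp only [Finset.mem_sigma, Finset.mem_erase] at h ⊢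
      exact ⟨h.2.2, h.2.1.symm, h.1⟩
    · rintro ⟨v, w⟩ h
      rfl

/-- The space of (augmented) simplicial `i`-chains of `Δ`, spanned by the faces with `i + 1`
elements. -/
noncomputable def chains (Δ : FiniteComplex V) (i : ℤ) : Submodule k (Finset V →₀ k) :=
  Finsupp.supported k k {F | F ∈ Δ.faces ∧ (F.card : ℤ) = i + 1}

/-- The space of `i`-cycles of `Δ`. -/
noncomputable def cycles (Δ : FiniteComplex V) (i : ℤ) : Submodule k (Finset V →₀ k) :=
  Δ.chains k i ⊓ LinearMap.ker (boundary k)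

/-- The space of `i`-boundaries of `Δ`. -/
noncomputable def boundaries (Δ : FiniteComplex V) (i : ℤ) : Submodule k (Finset V →₀ k) :=
  (Δ.chains k (i + 1)).map (boundary k)

/-- Boundaries are cycles. -/
theorem boundaries_le_cycles (Δ : FiniteComplex V) (i : ℤ) :
    Δ.boundaries k i ≤ Δ.cycles k i := by
  rintro _ ⟨c, hc, rfl⟩
  refine ⟨?_, boundary_boundary k c⟩
  simp only [boundary, Finsupp.linearCombination_apply, Finsupp.sum]
  refine Submodule.sum_mem _ fun F hF => Submodule.smul_mem _ _ (Submodule.sum_mem _ fun v hv =>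
    Submodule.smul_mem _ _ (Finsupp.single_mem_supported k 1 ?_))
  have hF' := (Finsupp.mem_supported k c).1 hc hF
  simp only [Set.mem_ofPred_eq] at hF' ⊢
  refine ⟨Δ.down_closed hF'.1 (Finset.erase_subset v F), ?_⟩
  have := Finset.card_erase_add_one hv
  omega

/-- The reduced simplicial homology of `Δ` in degree `i` with coefficients in `k`: cycles modulo
boundaries. -/
abbrev ReducedHomology (Δ : FiniteComplex V) (i : ℤ) : Type _ :=
  (Δ.cycles k i) ⧸ (Δ.boundaries k i).submoduleOf (Δ.cycles k i)

/-- `Δ` is a homology sphere over `k`: the reduced homology of the link of every face is `k` in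
degree the dimension of the link, and zero in all other degrees. -/
def IsHomologySphere (Δ : FiniteComplex V) : Prop :=
  ∀ (F : Finset V) (hF : F ∈ Δ.faces) (i : ℤ),
    (i = (Δ.link F hF).dim → Nonempty ((Δ.link F hF).ReducedHomology k i ≃ₗ[k] k)) ∧
    (i ≠ (Δ.link F hF).dim → Subsingleton ((Δ.link F hF).ReducedHomology k i))

/-- `Δ` is a homology ball over `k` with boundary `B`: `B` is a subcomplex of `Δ` and a homology
sphere of dimension `dim Δ - 1`, and for every face `F` of `Δ` the reduced homology of the link of
`F` is `k` in degree the dimension of the link if `F` is not in `B`, and zero otherwise. (These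
conditions determine `B`.) -/
def IsHomologyBall (Δ B : FiniteComplex V) : Prop :=
  B.faces ⊆ Δ.faces ∧ B.IsHomologySphere k ∧ B.dim = Δ.dim - 1 ∧
  ∀ (F : Finset V) (hF : F ∈ Δ.faces) (i : ℤ),
    ((F ∉ B.faces ∧ i = (Δ.link F hF).dim) →
      Nonempty ((Δ.link F hF).ReducedHomology k i ≃ₗ[k] k)) ∧
    (¬ (F ∉ B.faces ∧ i = (Δ.link F hF).dim) →
      Subsingleton ((Δ.link F hF).ReducedHomology k i))

end Homology

end FiniteComplex

/-- `g = ∑_i γ_i x^i` is the `γ`-polynomial of `p` with respect to the center of symmetry `n/2`: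
it has degree at most `⌊n/2⌋` and `p = ∑_{i=0}^{⌊n/2⌋} γ_i x^i (1+x)^{n-2i}`.
(There is at most one such `g`.) -/
def IsGammaPolynomial (n : ℕ) (p g : ℝ[X]) : Prop :=
  g.natDegree ≤ n / 2 ∧
    p = ∑ i ∈ Finset.range (n / 2 + 1), C (g.coeff i) * X ^ i * (1 + X) ^ (n - 2 * i)

/-- `p` is `γ`-positive with center of symmetry `n/2`. -/
def IsGammaPositive (n : ℕ) (p : ℝ[X]) : Prop :=
  ∃ γ : ℕ → ℝ, (∀ i, 0 ≤ γ i) ∧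
    p = ∑ i ∈ Finset.range (n / 2 + 1), C (γ i) * X ^ i * (1 + X) ^ (n - 2 * i)

/-- The coefficientwise inequality `γ(Γ, x) ≤ γ(Δ, x)`: the `h`-polynomials of `Γ` and `Δ` have
`γ`-polynomials, each with respect to the center `(dim + 1)/2`, and every coefficient of the former
is at most the corresponding coefficient of the latter. -/
def GammaLE {V : Type*} [DecidableEq V] (Γ Δ : FiniteComplex V) : Prop :=
  ∃ g g' : ℝ[X], IsGammaPolynomial Γ.rank Γ.hPoly g ∧ IsGammaPolynomial Δ.rank Δ.hPoly g' ∧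
    ∀ i : ℕ, g.coeff i ≤ g'.coeff i

/-!
An induced codimension-one homology sphere `Γ` separates a flag homology sphere `Δ` into two flag
homology balls `Δ₁`, `Δ₂` with common boundary `Γ`, and then
`h(Δ, x) - (1 + x) h(Γ, x) = θ(Δ₁, x) + θ(Δ₂, x)`. By the Dehn–Sommerville relations, which make the
`γ`-polynomials exist, `γ(Δ, x) ≥ γ(Γ, x)` says exactly that the left-hand side is `γ`-positive.
Vertex links in flag spheres are induced spheres of this kind. Conversely, coning off the induced
boundary of a flag homology ball with a new apex gives a flag homology sphere `Σ` for which
`θ = h(Σ, x) - (1 + x) h(link of the apex, x)`.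
-/

namespace FiniteComplex

section Basic

variable {V : Type*} {Γ Δ : FiniteComplex V} {F G : Finset V}

theorem card_le_rank (hF : F ∈ Δ.faces) : F.card ≤ Δ.rank :=
  Finset.le_sup (f := Finset.card) hF

theorem singleton_mem {v : V} (hF : F ∈ Δ.faces) (hv : v ∈ F) : {v} ∈ Δ.faces :=
  Δ.down_closed hF (Finset.singleton_subset_iff.2 hv)

theorem exists_card_eq_rank (Δ : FiniteComplex V) : ∃ F ∈ Δ.faces, F.card = Δ.rank := by
  obtain ⟨F, hF, h⟩ := Finset.exists_mem_eq_sup Δ.faces ⟨∅, Δ.empty_mem⟩ Finset.card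
  exact ⟨F, hF, h.symm⟩

theorem rank_eq_of_forall {m : ℕ} (h : ∀ F ∈ Δ.faces, F.card ≤ m) (hF : F ∈ Δ.faces)
    (hm : F.card = m) : Δ.rank = m :=
  le_antisymm (Finset.sup_le h) (hm ▸ card_le_rank hF)

theorem dim_eq_natCast_sub_one_iff {n : ℕ} : Δ.dim = n - 1 ↔ Δ.rank = n := by
  rw [dim]
  omega

theorem dim_add_one_eq_dim_iff {W : Type*} {Γ : FiniteComplex W} :
    Γ.dim + 1 = Δ.dim ↔ Γ.rank + 1 = Δ.rank := by
  simp only [dim]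
  omega

theorem IsInducedSubcomplex.mono {Δ' : FiniteComplex V} (h : Γ.IsInducedSubcomplex Δ')
    (hΓ : Γ.faces ⊆ Δ.faces) (hΔ : Δ.faces ⊆ Δ'.faces) : Γ.IsInducedSubcomplex Δ :=
  ⟨hΓ, fun F hF => h.2 F (hΔ hF)⟩

open Classical in
/-- The subcomplex of `Δ` induced on the set `S`: the faces all of whose vertices lie in `S`. -/
noncomputable def restrict (Δ : FiniteComplex V) (S : Set V) : FiniteComplex V where
  faces := Δ.faces.filter fun F => ∀ v ∈ F, v ∈ S
  empty_mem := by simp [Δ.empty_mem]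
  down_closed hG hFG := by
    rw [Finset.mem_filter] at hG ⊢
    exact ⟨Δ.down_closed hG.1 hFG, fun v hv => hG.2 v (hFG hv)⟩

theorem mem_restrict {S : Set V} :
    F ∈ (Δ.restrict S).faces ↔ F ∈ Δ.faces ∧ ∀ v ∈ F, v ∈ S := by
  classical simp only [restrict, Finset.mem_filter]

theorem isInducedSubcomplex_restrict (Δ : FiniteComplex V) (S : Set V) :
    (Δ.restrict S).IsInducedSubcomplex Δ :=
  ⟨fun _ hF => (mem_restrict.1 hF).1, fun _ hF h => mem_restrict.2
    ⟨hF, fun v hv => (mem_restrict.1 (h v hv)).2 v (Finset.mem_singleton_self v)⟩⟩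

variable [DecidableEq V]

theorem mem_link {hF : F ∈ Δ.faces} :
    G ∈ (Δ.link F hF).faces ↔ Disjoint F G ∧ F ∪ G ∈ Δ.faces := by
  simp only [link, Finset.mem_filter, and_iff_right_iff_imp]
  exact fun h => Δ.down_closed h.2 Finset.subset_union_right

theorem mem_link_singleton {v : V} {hv : {v} ∈ Δ.faces} :
    G ∈ (Δ.link {v} hv).faces ↔ v ∉ G ∧ insert v G ∈ Δ.faces := by
  rw [mem_link, Finset.disjoint_singleton_left, Finset.insert_eq]

theorem singleton_mem_link_singleton {v w : V} {hv : {v} ∈ Δ.faces} :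
    {w} ∈ (Δ.link {v} hv).faces ↔ v ≠ w ∧ {v, w} ∈ Δ.faces := by
  rw [mem_link_singleton, Finset.notMem_singleton]

theorem erase_mem_link_singleton {v : V} {hv : {v} ∈ Δ.faces} (hvF : v ∈ F) (hF : F ∈ Δ.faces) :
    F.erase v ∈ (Δ.link {v} hv).faces :=
  mem_link_singleton.2 ⟨Finset.notMem_erase v F, by rwa [Finset.insert_erase hvF]⟩

theorem link_subset (hF : F ∈ Δ.faces) : (Δ.link F hF).faces ⊆ Δ.faces :=
  fun _ hG => Δ.down_closed (mem_link.1 hG).2 Finset.subset_union_right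

theorem link_link (hF : F ∈ Δ.faces) (hG : G ∈ (Δ.link F hF).faces) :
    (Δ.link F hF).link G hG = Δ.link (F ∪ G) (mem_link.1 hG).2 := by
  ext H
  have h := (mem_link.1 hG).1
  simp only [mem_link, Finset.disjoint_union_left, Finset.disjoint_union_right, Finset.union_assoc]
  tauto

theorem link_empty (Δ : FiniteComplex V) : Δ.link ∅ Δ.empty_mem = Δ := by
  ext H
  simp [mem_link]

theorem rank_link_add_card_le (hF : F ∈ Δ.faces) : (Δ.link F hF).rank + F.card ≤ Δ.rank := by
  obtain ⟨G, hG, hcard⟩ := (Δ.link F hF).exists_card_eq_rank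
  obtain ⟨hdisj, hunion⟩ := mem_link.1 hG
  have := card_le_rank hunion
  rw [Finset.card_union_of_disjoint hdisj] at this
  omega

theorem rank_link_add_card_of_subset (hF : F ∈ Δ.faces) (hG : G ∈ Δ.faces) (hFG : F ⊆ G)
    (hcard : G.card = Δ.rank) : (Δ.link F hF).rank + F.card = Δ.rank := by
  refine (rank_link_add_card_le hF).antisymm ?_
  have hmem : G \ F ∈ (Δ.link F hF).faces :=
    mem_link.2 ⟨Finset.disjoint_sdiff, by rwa [Finset.union_sdiff_of_subset hFG]⟩
  have := card_le_rank hmem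
  rw [Finset.card_sdiff_of_subset hFG] at this
  omega

end Basic

section Chains

variable {V : Type*} {k : Type*} [Field k] {Γ Δ Δ₁ Δ₂ : FiniteComplex V} {i : ℤ}
  {c : Finset V →₀ k}

theorem mem_chains :
    c ∈ Δ.chains k i ↔ ∀ F, c F ≠ 0 → F ∈ Δ.faces ∧ (F.card : ℤ) = i + 1 := by
  rw [chains, Finsupp.mem_supported]
  exact ⟨fun h F hF => h (by simpa using hF), fun h F hF => h F (by simpa using hF)⟩

theorem single_mem_chains {F : Finset V} (hF : F ∈ Δ.faces) (hi : (F.card : ℤ) = i + 1) (a : k) :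
    Finsupp.single F a ∈ Δ.chains k i :=
  Finsupp.single_mem_supported k a ⟨hF, hi⟩

theorem chains_mono (h : Γ.faces ⊆ Δ.faces) (i : ℤ) : Γ.chains k i ≤ Δ.chains k i :=
  Finsupp.supported_mono fun _ hF => ⟨h hF.1, hF.2⟩

theorem chains_le_sup_chains
    (h : ∀ F ∈ Δ.faces, (F.card : ℤ) = i + 1 → F ∈ Δ₁.faces ∨ F ∈ Δ₂.faces) :
    Δ.chains k i ≤ Δ₁.chains k i ⊔ Δ₂.chains k i := by
  rw [chains, chains, chains, ← Finsupp.supported_union]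
  exact Finsupp.supported_mono fun F hF =>
    (h F hF.1 hF.2).imp (fun hF' => ⟨hF', hF.2⟩) fun hF' => ⟨hF', hF.2⟩

theorem chains_eq_bot_of_dim_lt (h : Δ.dim < i) : Δ.chains k i = ⊥ := by
  refine (Submodule.eq_bot_iff _).2 fun c hc => Finsupp.ext fun F => ?_
  by_contra hF
  obtain ⟨hmem, hcard⟩ := mem_chains.1 hc F hF
  have := card_le_rank hmem
  rw [dim] at h
  omega

end Chains

section Contraction

variable {V : Type*} [LinearOrder V] (k : Type*) [Field k]

/-- The sign of the facet `F.erase v` in the boundary of the simplex `F`. -/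
def incidence (v : V) (F : Finset V) : k := (-1) ^ (F.filter (fun w => w < v)).card

theorem incidence_ne_zero (v : V) (F : Finset V) : incidence k v F ≠ 0 :=
  pow_ne_zero _ (by simp)

theorem incidence_mul_incidence_erase {F : Finset V} {v w : V} (hv : v ∈ F) (hw : w ∈ F)
    (hvw : v ≠ w) :
    incidence k v F * incidence k w (F.erase v) =
      -(incidence k w F * incidence k v (F.erase w)) := by
  wlog h : v < w generalizing v w
  · rw [this hw hv hvw.symm (hvw.lt_or_gt.resolve_left h), neg_neg]
  have hbelow_v : (F.erase w).filter (· < v) = F.filter (· < v) := by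
    rw [Finset.filter_erase, Finset.erase_eq_of_notMem]
    simp [h.le]
  have hbelow_w : (F.filter (· < w)).card = ((F.erase v).filter (· < w)).card + 1 := by
    rw [Finset.filter_erase, Finset.card_erase_add_one (by simp [hv, h])]
  rw [incidence, incidence, incidence, incidence, hbelow_v, hbelow_w]
  ring

theorem boundary_single (F : Finset V) (a : k) :
    boundary k (Finsupp.single F a) =
      a • ∑ v ∈ F, incidence k v F • Finsupp.single (F.erase v) (1 : k) := by
  simp [boundary, incidence]

/-- Contraction by the vertex `v`: the simplices that contain `v` are replaced, with the sign of
the boundary operator, by their facets opposite to `v`, and the other simplices by zero. It maps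
the chains of a complex to the chains of the link of `v`. -/
noncomputable def contract (v : V) : (Finset V →₀ k) →ₗ[k] (Finset V →₀ k) :=
  Finsupp.linearCombination k fun F : Finset V =>
    if v ∈ F then incidence k v F • Finsupp.single (F.erase v) (1 : k) else 0

theorem contract_single (v : V) (F : Finset V) (a : k) :
    contract k v (Finsupp.single F a) =
      if v ∈ F then a • incidence k v F • Finsupp.single (F.erase v) (1 : k) else 0 := by
  simp [contract]

theorem contract_apply (v : V) (c : Finset V →₀ k) (G : Finset V) :
    contract k v c G = if v ∈ G then 0 else incidence k v (insert v G) * c (insert v G) := by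
  induction c using Finsupp.induction_linear with
  | zero => simp
  | add f g hf hg =>
    rw [map_add, Finsupp.add_apply, hf, hg, Finsupp.add_apply]
    split_ifs <;> ring
  | single F a =>
    rw [contract_single]
    by_cases hF : v ∈ F
    · have herase : F.erase v = G ↔ v ∉ G ∧ F = insert v G := by
        constructor
        · rintro rfl
          exact ⟨Finset.notMem_erase v F, (Finset.insert_erase hF).symm⟩
        · rintro ⟨hG, rfl⟩
          exact Finset.erase_insert hG
      by_cases hG : v ∈ G
      · simp [hF, hG, herase]
      · by_cases h : F = insert v G
        · simp [h, hG, Finset.erase_insert hG, mul_comm]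
        · simp [hF, hG, h, herase]
    · have h : F ≠ insert v G := fun h => hF (h ▸ Finset.mem_insert_self v G)
      simp [hF, Finsupp.single_eq_of_ne h.symm]

theorem contract_boundary (v : V) (c : Finset V →₀ k) :
    contract k v (boundary k c) = -boundary k (contract k v c) := by
  induction c using Finsupp.induction_linear with
  | zero => simp
  | add f g hf hg => simp only [map_add, hf, hg, neg_add]
  | single F a =>
    rw [boundary_single, contract_single]
    by_cases hv : v ∈ F
    · rw [if_pos hv]
      simp only [map_smul, map_sum, contract_single, boundary_single, one_smul, Finset.smul_sum,
        ← Finset.sum_neg_distrib]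
      rw [← Finset.add_sum_erase F _ hv, if_neg (by simp), smul_zero, smul_zero, zero_add]
      refine Finset.sum_congr rfl fun w hw => ?_
      obtain ⟨hwv, hw⟩ := Finset.mem_erase.1 hw
      rw [if_pos (Finset.mem_erase.2 ⟨hwv.symm, hv⟩), Finset.erase_right_comm,
        smul_smul (incidence k w F), smul_smul (incidence k v F),
        incidence_mul_incidence_erase k hw hv hwv, neg_smul, smul_neg]
    · rw [if_neg hv]
      simp only [map_smul, map_sum, contract_single, map_zero, neg_zero]
      refine smul_eq_zero_of_right _ (Finset.sum_eq_zero fun w _ => ?_)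
      rw [if_neg (fun h => hv (Finset.mem_of_mem_erase h)), smul_zero]

variable {k} {Γ Δ : FiniteComplex V} {i : ℤ} {c : Finset V →₀ k} {v : V}

theorem contract_apply_eq_zero_iff {G : Finset V} (hv : v ∉ G) :
    contract k v c G = 0 ↔ c (insert v G) = 0 := by
  simp [contract_apply, hv, incidence_ne_zero]

theorem contract_eq_zero_iff : contract k v c = 0 ↔ ∀ F, v ∈ F → c F = 0 := by
  constructor
  · intro h F hv
    rw [← Finset.insert_erase hv, ← contract_apply_eq_zero_iff (Finset.notMem_erase v F), h,
      Finsupp.zero_apply]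
  · intro h
    ext G
    rw [contract_apply, h _ (Finset.mem_insert_self v G)]
    simp

theorem mem_cycles : c ∈ Δ.cycles k i ↔ c ∈ Δ.chains k i ∧ boundary k c = 0 := Iff.rfl

theorem boundary_apply_eq_zero {G : Finset V} (h : ∀ v ∉ G, c (insert v G) = 0) :
    boundary k c G = 0 := by
  rw [← Finsupp.sum_single c, map_finsuppSum, Finsupp.sum, Finsupp.finsetSum_apply]
  refine Finset.sum_eq_zero fun F hF => ?_
  rw [boundary_single, Finsupp.smul_apply, Finsupp.finsetSum_apply]
  refine smul_eq_zero_of_right _ (Finset.sum_eq_zero fun v hv => ?_)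
  rw [Finsupp.smul_apply, Finsupp.single_eq_of_ne, smul_zero]
  rintro rfl
  apply Finsupp.mem_support_iff.1 hF
  simpa only [Finset.insert_erase hv] using h v (Finset.notMem_erase v F)

theorem boundary_mem_cycles (hc : c ∈ Δ.chains k (i + 1)) : boundary k c ∈ Δ.cycles k i :=
  boundaries_le_cycles k Δ i ⟨c, hc, rfl⟩

theorem boundary_mem_chains (hc : c ∈ Δ.chains k (i + 1)) : boundary k c ∈ Δ.chains k i :=
  (boundary_mem_cycles hc).1

theorem cycles_mono (h : Γ.faces ⊆ Δ.faces) (i : ℤ) : Γ.cycles k i ≤ Δ.cycles k i :=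
  inf_le_inf_right _ (chains_mono h i)

theorem contract_mem_chains (hv : {v} ∈ Δ.faces) (hc : c ∈ Δ.chains k (i + 1)) :
    contract k v c ∈ (Δ.link {v} hv).chains k i := by
  refine mem_chains.2 fun G hG => ?_
  have hvG : v ∉ G := fun h => hG (by simp [contract_apply, h])
  obtain ⟨hmem, hcard⟩ := mem_chains.1 hc _ ((contract_apply_eq_zero_iff hvG).not.1 hG)
  rw [Finset.card_insert_of_notMem hvG] at hcard
  exact ⟨mem_link_singleton.2 ⟨hvG, hmem⟩, by push_cast at hcard; omega⟩

theorem contract_mem_cycles (hv : {v} ∈ Δ.faces) (hc : c ∈ Δ.cycles k (i + 1)) :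
    contract k v c ∈ (Δ.link {v} hv).cycles k i :=
  mem_cycles.2 ⟨contract_mem_chains hv hc.1, by
    rw [← neg_eq_zero, ← contract_boundary, (mem_cycles.1 hc).2, map_zero]⟩

theorem subsingleton_reducedHomology :
    Subsingleton (Δ.ReducedHomology k i) ↔ Δ.cycles k i ≤ Δ.boundaries k i := by
  rw [Submodule.Quotient.subsingleton_iff, Submodule.submoduleOf_eq_top]

theorem boundaries_dim_eq_bot (Δ : FiniteComplex V) : Δ.boundaries k Δ.dim = ⊥ := by
  rw [boundaries, chains_eq_bot_of_dim_lt (lt_add_one _), Submodule.map_bot]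

theorem single_sub_single_mem_cycles {u v : V} (hu : {u} ∈ Δ.faces) (hv : {v} ∈ Δ.faces) :
    Finsupp.single {u} 1 - Finsupp.single {v} 1 ∈ Δ.cycles k 0 := by
  refine mem_cycles.2
    ⟨sub_mem (single_mem_chains hu (by simp) 1) (single_mem_chains hv (by simp) 1), ?_⟩
  rw [map_sub, boundary_single, boundary_single]
  simp [incidence, Finset.filter_singleton]

theorem mem_of_forall_edge (h : Δ.cycles k 0 ≤ Δ.boundaries k 0) {S : Set V}
    (hS : ∀ u v, u ≠ v → {u, v} ∈ Δ.faces → u ∈ S → v ∈ S) {u v : V} (hu : {u} ∈ Δ.faces)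
    (hv : {v} ∈ Δ.faces) (huS : u ∈ S) : v ∈ S := by
  -- If `y` bounds `[u] - [v]` and `y₁` is the part of `y` inside `S`, then `∂y₁ - [u]` is supported
  -- both inside and outside `S`. So `[u] = ∂y₁`, but the augmentation of `[u]` is not zero.
  by_contra hvS
  obtain ⟨y, hy, hyuv⟩ := h (single_sub_single_mem_cycles hu hv)
  have hsplit : Δ.chains k 1 ≤ (Δ.restrict S).chains k 1 ⊔ (Δ.restrict Sᶜ).chains k 1 := by
    refine chains_le_sup_chains fun F hF hcard => ?_
    obtain ⟨a, b, hab, rfl⟩ := Finset.card_eq_two.1 (by omega : F.card = 2)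
    have hba := hS b a hab.symm (by rwa [Finset.pair_comm])
    simp only [mem_restrict, hF, Finset.mem_insert, Finset.mem_singleton, forall_eq_or_imp,
      forall_eq, Set.mem_compl_iff, true_and]
    tauto
  obtain ⟨y₁, hy₁, y₂, hy₂, rfl⟩ := Submodule.mem_sup.1 (hsplit hy)
  have hinside : boundary k y₁ - Finsupp.single {u} 1 ∈ (Δ.restrict S).chains k 0 :=
    sub_mem (boundary_mem_chains hy₁)
      (single_mem_chains (mem_restrict.2 ⟨hu, by simpa using huS⟩) (by simp) 1)
  have houtside : boundary k y₁ - Finsupp.single {u} 1 ∈ (Δ.restrict Sᶜ).chains k 0 := by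
    have heq : boundary k y₁ - Finsupp.single {u} 1 =
        -(boundary k y₂) - Finsupp.single {v} 1 := by
      rw [map_add] at hyuv
      rw [eq_sub_of_add_eq hyuv]
      abel
    rw [heq]
    exact sub_mem (neg_mem (boundary_mem_chains hy₂))
      (single_mem_chains (mem_restrict.2 ⟨hv, by simpa using hvS⟩) (by simp) 1)
  have hbound : boundary k y₁ = Finsupp.single {u} 1 := by
    refine sub_eq_zero.1 (Finsupp.ext fun F => ?_)
    by_contra hF
    obtain ⟨hF₁, hcard⟩ := mem_chains.1 hinside F hF
    obtain ⟨w, rfl⟩ := Finset.card_eq_one.1 (by omega : F.card = 1)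
    have hF₂ := (mem_chains.1 houtside _ hF).1
    exact (mem_restrict.1 hF₂).2 w (by simp) ((mem_restrict.1 hF₁).2 w (by simp))
  have haug := boundary_boundary k y₁
  rw [hbound, boundary_single] at haug
  simp [incidence_ne_zero] at haug

end Contraction

section Sphere

variable {V : Type*} [LinearOrder V] {k : Type*} [Field k] {Δ : FiniteComplex V}
  {F : Finset V} {z : Finset V →₀ k}

theorem nonempty_reducedHomology_dim_iff :
    Nonempty (Δ.ReducedHomology k Δ.dim ≃ₗ[k] k) ↔ Module.finrank k (Δ.cycles k Δ.dim) = 1 := by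
  have hbot : (Δ.boundaries k Δ.dim).submoduleOf (Δ.cycles k Δ.dim) = ⊥ := by
    rw [boundaries_dim_eq_bot, Submodule.submoduleOf, Submodule.comap_bot, Submodule.ker_subtype]
  let e : Δ.ReducedHomology k Δ.dim ≃ₗ[k] Δ.cycles k Δ.dim := Submodule.quotEquivOfEqBot _ hbot
  rw [← e.finrank_eq]
  refine ⟨fun ⟨f⟩ => f.finrank_eq.trans (Module.finrank_self k), fun h => ?_⟩
  have := Module.finite_of_finrank_eq_succ h
  exact ⟨LinearEquiv.ofFinrankEq _ _ (h.trans (Module.finrank_self k).symm)⟩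

variable (k) in
/-- All reduced homology of `Δ` vanishes. This is the condition on the links of the boundary faces
of a homology ball. -/
def IsAcyclic (Δ : FiniteComplex V) : Prop := ∀ i, Subsingleton (Δ.ReducedHomology k i)

variable (k) in
/-- `Δ` has the reduced homology of a sphere of the same dimension. This is the condition on the
links of a homology sphere and on the links of the interior faces of a homology ball. -/
def HasSphereHomology (Δ : FiniteComplex V) : Prop :=
  ∀ i, (i = Δ.dim → Nonempty (Δ.ReducedHomology k i ≃ₗ[k] k)) ∧
    (i ≠ Δ.dim → Subsingleton (Δ.ReducedHomology k i))

theorem IsHomologySphere.hasSphereHomology_link (h : Δ.IsHomologySphere k) (hF : F ∈ Δ.faces) :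
    (Δ.link F hF).HasSphereHomology k :=
  h F hF

theorem isHomologyBall_iff {B : FiniteComplex V} :
    Δ.IsHomologyBall k B ↔ B.faces ⊆ Δ.faces ∧ B.IsHomologySphere k ∧ B.rank + 1 = Δ.rank ∧
      ∀ F (hF : F ∈ Δ.faces), (F ∈ B.faces → (Δ.link F hF).IsAcyclic k) ∧
        (F ∉ B.faces → (Δ.link F hF).HasSphereHomology k) := by
  rw [IsHomologyBall, eq_sub_iff_add_eq, dim_add_one_eq_dim_iff]
  refine and_congr_right' <| and_congr_right' <| and_congr_right' <|
    forall_congr' fun F => forall_congr' fun hF => ?_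
  by_cases hFB : F ∈ B.faces <;> simp [hFB, IsAcyclic, HasSphereHomology]

theorem IsHomologySphere.link (h : Δ.IsHomologySphere k) (hF : F ∈ Δ.faces) :
    (Δ.link F hF).IsHomologySphere k := fun G hG => by
  rw [link_link]
  exact h.hasSphereHomology_link _

theorem IsHomologySphere.hasSphereHomology (h : Δ.IsHomologySphere k) :
    Δ.HasSphereHomology k := by
  simpa only [link_empty] using h.hasSphereHomology_link Δ.empty_mem

theorem IsHomologySphere.cycles_le_boundaries (h : Δ.IsHomologySphere k) {i : ℤ}
    (hi : i ≠ Δ.dim) : Δ.cycles k i ≤ Δ.boundaries k i :=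
  subsingleton_reducedHomology.1 ((h.hasSphereHomology i).2 hi)

theorem IsHomologySphere.finrank_cycles_dim (h : Δ.IsHomologySphere k) :
    Module.finrank k (Δ.cycles k Δ.dim) = 1 :=
  nonempty_reducedHomology_dim_iff.1 ((h.hasSphereHomology Δ.dim).1 rfl)

theorem IsHomologySphere.exists_mem_cycles_ne_zero (h : Δ.IsHomologySphere k) :
    ∃ z ∈ Δ.cycles k Δ.dim, z ≠ 0 := by
  refine Submodule.exists_mem_ne_zero_of_ne_bot fun hbot => ?_
  have hone := h.finrank_cycles_dim
  rw [hbot, finrank_bot] at hone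
  exact zero_ne_one hone

theorem IsHomologySphere.exists_smul_eq (h : Δ.IsHomologySphere k) (hz : z ∈ Δ.cycles k Δ.dim)
    (hz₀ : z ≠ 0) {x : Finset V →₀ k} (hx : x ∈ Δ.cycles k Δ.dim) : ∃ a : k, a • z = x := by
  obtain ⟨a, ha⟩ := exists_smul_eq_of_finrank_eq_one h.finrank_cycles_dim
    (x := ⟨z, hz⟩) (by simpa using hz₀) ⟨x, hx⟩
  exact ⟨a, congrArg Subtype.val ha⟩

theorem IsHomologySphere.mem_of_forall_edge (h : Δ.IsHomologySphere k) (hr : 2 ≤ Δ.rank)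
    {S : Set V} (hS : ∀ u v, u ≠ v → {u, v} ∈ Δ.faces → u ∈ S → v ∈ S) {u v : V}
    (hu : {u} ∈ Δ.faces) (hv : {v} ∈ Δ.faces) (huS : u ∈ S) : v ∈ S :=
  FiniteComplex.mem_of_forall_edge (h.cycles_le_boundaries (by rw [dim]; omega)) hS hu hv huS

theorem IsHomologySphere.exists_facet_of_vertex (h : Δ.IsHomologySphere k) {v : V}
    (hv : {v} ∈ Δ.faces) : ∃ G ∈ Δ.faces, v ∈ G ∧ G.card = Δ.rank := by
  induction hn : Δ.rank using Nat.strong_induction_on generalizing Δ v with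
  | _ n ih =>
  subst hn
  have hpos := card_le_rank hv
  rw [Finset.card_singleton] at hpos
  rcases hpos.eq_or_lt with hone | htwo
  · exact ⟨{v}, hv, by simp, by simpa using hone⟩
  obtain ⟨F, hF, hFcard⟩ := Δ.exists_card_eq_rank
  obtain ⟨u, huF⟩ := Finset.card_pos.1 (by omega : 0 < F.card)
  refine h.mem_of_forall_edge htwo (S := {w | ∃ G ∈ Δ.faces, w ∈ G ∧ G.card = Δ.rank}) ?_
    (singleton_mem hF huF) hv ⟨F, hF, huF, hFcard⟩
  rintro a b hab hedge ⟨G, hG, haG, hGcard⟩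
  have ha : {a} ∈ Δ.faces := singleton_mem hG haG
  have hrank := rank_link_add_card_of_subset ha hG (by simpa using haG) hGcard
  rw [Finset.card_singleton] at hrank
  obtain ⟨H, hH, hbH, hHcard⟩ := ih _ (by omega) (h.link ha)
    (singleton_mem_link_singleton.2 ⟨hab, hedge⟩) rfl
  obtain ⟨haH, hH⟩ := mem_link_singleton.1 hH
  exact ⟨insert a H, hH, Finset.mem_insert_of_mem hbH, by
    rw [Finset.card_insert_of_notMem haH, hHcard, hrank]⟩

theorem IsHomologySphere.rank_link_singleton (h : Δ.IsHomologySphere k) {v : V}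
    (hv : {v} ∈ Δ.faces) : (Δ.link {v} hv).rank + 1 = Δ.rank := by
  obtain ⟨G, hG, hvG, hcard⟩ := h.exists_facet_of_vertex hv
  simpa using rank_link_add_card_of_subset hv hG (by simpa using hvG) hcard

theorem IsHomologySphere.exists_facet (h : Δ.IsHomologySphere k) (hF : F ∈ Δ.faces) :
    ∃ G ∈ Δ.faces, F ⊆ G ∧ G.card = Δ.rank := by
  induction F using Finset.induction_on generalizing Δ with
  | empty =>
    obtain ⟨G, hG, hcard⟩ := Δ.exists_card_eq_rank
    exact ⟨G, hG, Finset.empty_subset G, hcard⟩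
  | insert v F hvF ih =>
    have hv : {v} ∈ Δ.faces := singleton_mem hF (Finset.mem_insert_self v F)
    obtain ⟨G, hG, hFG, hcard⟩ := ih (h.link hv) (mem_link_singleton.2 ⟨hvF, hF⟩)
    obtain ⟨hvG, hG⟩ := mem_link_singleton.1 hG
    exact ⟨insert v G, hG, Finset.insert_subset_insert v hFG, by
      rw [Finset.card_insert_of_notMem hvG, hcard, h.rank_link_singleton hv]⟩

theorem IsHomologySphere.rank_link (h : Δ.IsHomologySphere k) (hF : F ∈ Δ.faces) :
    (Δ.link F hF).rank + F.card = Δ.rank := by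
  obtain ⟨G, hG, hFG, hcard⟩ := h.exists_facet hF
  exact rank_link_add_card_of_subset hF hG hFG hcard

theorem IsHomologySphere.dim_link_singleton (h : Δ.IsHomologySphere k) {v : V}
    (hv : {v} ∈ Δ.faces) : (Δ.link {v} hv).dim + 1 = Δ.dim :=
  dim_add_one_eq_dim_iff.2 (h.rank_link_singleton hv)

theorem IsHomologySphere.contract_mem_cycles_dim (h : Δ.IsHomologySphere k)
    (hz : z ∈ Δ.cycles k Δ.dim) {v : V} (hv : {v} ∈ Δ.faces) :
    contract k v z ∈ (Δ.link {v} hv).cycles k (Δ.link {v} hv).dim :=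
  contract_mem_cycles hv (by rwa [h.dim_link_singleton hv])

theorem IsHomologySphere.eq_zero_of_apply_singleton_eq_zero (h : Δ.IsHomologySphere k)
    (hr : Δ.rank = 1) (hz : z ∈ Δ.cycles k Δ.dim) {v : V} (hv : {v} ∈ Δ.faces)
    (hzv : z {v} = 0) : z = 0 := by
  by_contra hz₀
  have hdim : Δ.dim = 0 := by simp [dim, hr]
  obtain ⟨F, hzF⟩ := Finsupp.ne_iff.1 hz₀
  obtain ⟨hF, hcard⟩ := mem_chains.1 hz.1 F hzF
  obtain ⟨u, rfl⟩ := Finset.card_eq_one.1 (by omega : F.card = 1)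
  have huv : u ≠ v := fun huv => hzF (by rw [huv, hzv, Finsupp.zero_apply])
  obtain ⟨a, ha⟩ := h.exists_smul_eq hz hz₀ (hdim ▸ single_sub_single_mem_cycles hF hv)
  simpa [hzv, Finsupp.single_apply, huv] using DFunLike.congr_fun ha {v}

theorem IsHomologySphere.eq_zero_of_apply_eq_zero (h : Δ.IsHomologySphere k)
    (hz : z ∈ Δ.cycles k Δ.dim) (hF : F ∈ Δ.faces) (hcard : F.card = Δ.rank) (hzF : z F = 0) :
    z = 0 := by
  induction hn : Δ.rank using Nat.strong_induction_on generalizing Δ F z with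
  | _ n ih =>
  subst hn
  -- By induction, `z` vanishes on the star of a vertex as soon as it vanishes on one facet of that
  -- star, so this property passes along edges to all vertices.
  by_contra hz₀
  obtain ⟨G, hzG⟩ := Finsupp.ne_iff.1 hz₀
  obtain ⟨hG, hGcard⟩ := mem_chains.1 hz.1 G hzG
  rw [dim, sub_add_cancel, Nat.cast_inj] at hGcard
  rcases Nat.lt_trichotomy Δ.rank 1 with hzero | hone | htwo
  · rw [Finset.card_eq_zero.1 (by omega : G.card = 0),
      ← Finset.card_eq_zero.1 (by omega : F.card = 0)] at hzG
    exact hzG hzF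
  · obtain ⟨v, rfl⟩ := Finset.card_eq_one.1 (hcard.trans hone)
    exact hz₀ (h.eq_zero_of_apply_singleton_eq_zero hone hz hF hzF)
  obtain ⟨u, huF⟩ := Finset.card_pos.1 (by omega : 0 < F.card)
  obtain ⟨w, hwG⟩ := Finset.card_pos.1 (by omega : 0 < G.card)
  have hu : {u} ∈ Δ.faces := singleton_mem hF huF
  have hcontract_u : contract k u z = 0 := by
    have hrank := h.rank_link_singleton hu
    have := Finset.card_erase_add_one huF
    refine ih _ (by omega) (h.link hu) (h.contract_mem_cycles_dim hz hu)
      (erase_mem_link_singleton huF hF) (by omega) ?_ rfl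
    rwa [contract_apply_eq_zero_iff (Finset.notMem_erase u F), Finset.insert_erase huF]
  refine h.mem_of_forall_edge htwo (S := {x | contract k x z ≠ 0}) ?_
    (singleton_mem hG hwG) hu
    (contract_eq_zero_iff.not.2 fun hzero => hzG (hzero G hwG)) hcontract_u
  intro a b hab hedge hcontract_a
  have ha : {a} ∈ Δ.faces := singleton_mem hedge (Finset.mem_insert_self ..)
  obtain ⟨H, hH, hbH, hHcard⟩ := (h.link ha).exists_facet_of_vertex
    (singleton_mem_link_singleton.2 ⟨hab, hedge⟩)
  refine contract_eq_zero_iff.not.2 fun hzero => hcontract_a ?_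
  refine ih _ (by have := h.rank_link_singleton ha; omega) (h.link ha)
    (h.contract_mem_cycles_dim hz ha) hH hHcard ?_ rfl
  rw [contract_apply_eq_zero_iff (mem_link_singleton.1 hH).1]
  exact hzero _ (Finset.mem_insert_of_mem hbH)

theorem IsHomologySphere.eq_zero_of_contract_eq_zero (h : Δ.IsHomologySphere k)
    (hz : z ∈ Δ.cycles k Δ.dim) {v : V} (hv : {v} ∈ Δ.faces) (hzv : contract k v z = 0) :
    z = 0 := by
  obtain ⟨G, hG, hvG, hcard⟩ := h.exists_facet_of_vertex hv
  exact h.eq_zero_of_apply_eq_zero hz hG hcard (contract_eq_zero_iff.1 hzv G hvG)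

end Sphere

section Decomposition

variable {V : Type*} [DecidableEq V]

/-- `L` is the union of its subcomplexes `L₁` and `L₂`, which intersect in `M` and neither of which
contains the other. This is the way in which a sphere `L` is separated by a sphere `M` of
codimension one. -/
structure IsDecomposition (L L₁ L₂ M : FiniteComplex V) : Prop where
  union : L.faces = L₁.faces ∪ L₂.faces
  inter : M.faces = L₁.faces ∩ L₂.faces
  left : ∃ F ∈ L₁.faces, F ∉ L₂.faces
  right : ∃ F ∈ L₂.faces, F ∉ L₁.faces

namespace IsDecomposition

variable {L L₁ L₂ M : FiniteComplex V} {F G : Finset V}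

theorem symm (h : IsDecomposition L L₁ L₂ M) : IsDecomposition L L₂ L₁ M :=
  ⟨by rw [h.union, Finset.union_comm], by rw [h.inter, Finset.inter_comm], h.right, h.left⟩

theorem left_subset (h : IsDecomposition L L₁ L₂ M) : L₁.faces ⊆ L.faces :=
  h.union ▸ Finset.subset_union_left

theorem inter_subset_left (h : IsDecomposition L L₁ L₂ M) : M.faces ⊆ L₁.faces :=
  h.inter ▸ Finset.inter_subset_left

theorem mem_or_mem (h : IsDecomposition L L₁ L₂ M) (hF : F ∈ L.faces) :
    F ∈ L₁.faces ∨ F ∈ L₂.faces := by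
  rwa [h.union, Finset.mem_union] at hF

theorem mem_inter (h : IsDecomposition L L₁ L₂ M) (hF₁ : F ∈ L₁.faces) (hF₂ : F ∈ L₂.faces) :
    F ∈ M.faces := by
  rw [h.inter]
  exact Finset.mem_inter.2 ⟨hF₁, hF₂⟩

theorem mem_left_of_subset (h : IsDecomposition L L₁ L₂ M) (hG : G ∈ L.faces) (hFG : F ⊆ G)
    (hF : F ∉ L₂.faces) : G ∈ L₁.faces :=
  (h.mem_or_mem hG).resolve_right fun hG₂ => hF (L₂.down_closed hG₂ hFG)

theorem link_left_eq (h : IsDecomposition L L₁ L₂ M) (hF : F ∈ L₁.faces) (hFM : F ∉ M.faces) :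
    L₁.link F hF = L.link F (h.left_subset hF) := by
  ext G
  rw [mem_link, mem_link]
  exact and_congr_right fun _ => ⟨fun hG => h.left_subset hG, fun hG =>
    h.mem_left_of_subset hG Finset.subset_union_left fun hF₂ => hFM (h.mem_inter hF hF₂)⟩

end IsDecomposition

end Decomposition

namespace IsDecomposition

variable {V : Type*} [LinearOrder V] {k : Type*} [Field k] {L L₁ L₂ M : FiniteComplex V}
  {F : Finset V} {i : ℤ}

theorem exists_add_eq (h : IsDecomposition L L₁ L₂ M) {y : Finset V →₀ k}
    (hy : y ∈ L.chains k i) : ∃ y₁ ∈ L₁.chains k i, ∃ y₂ ∈ L₂.chains k i, y₁ + y₂ = y :=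
  Submodule.mem_sup.1 (chains_le_sup_chains (fun _ hF _ => h.mem_or_mem hF) hy)

theorem mem_chains_inter (h : IsDecomposition L L₁ L₂ M) {y : Finset V →₀ k}
    (hy₁ : y ∈ L₁.chains k i) (hy₂ : y ∈ L₂.chains k i) : y ∈ M.chains k i := by
  rw [mem_chains] at hy₁ hy₂ ⊢
  exact fun F hF => ⟨h.mem_inter (hy₁ F hF).1 (hy₂ F hF).1, (hy₁ F hF).2⟩

theorem exists_facet_left (h : IsDecomposition L L₁ L₂ M) (hL : L.IsHomologySphere k) :
    ∃ G ∈ L₁.faces, G ∉ L₂.faces ∧ G.card = L.rank := by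
  obtain ⟨F, hF₁, hF₂⟩ := h.left
  obtain ⟨G, hG, hFG, hcard⟩ := hL.exists_facet (h.left_subset hF₁)
  exact ⟨G, h.mem_left_of_subset hG hFG hF₂, fun hG₂ => hF₂ (L₂.down_closed hG₂ hFG), hcard⟩

theorem rank_left (h : IsDecomposition L L₁ L₂ M) (hL : L.IsHomologySphere k) :
    L₁.rank = L.rank := by
  obtain ⟨G, hG₁, -, hcard⟩ := h.exists_facet_left hL
  exact rank_eq_of_forall (fun F hF => card_le_rank (h.left_subset hF)) hG₁ hcard

theorem eq_zero_of_mem_cycles_left (h : IsDecomposition L L₁ L₂ M) (hL : L.IsHomologySphere k)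
    {x : Finset V →₀ k} (hx : x ∈ L₁.cycles k L.dim) : x = 0 := by
  obtain ⟨G, hG₂, hG₁, hcard⟩ := h.symm.exists_facet_left hL
  refine hL.eq_zero_of_apply_eq_zero (cycles_mono h.left_subset _ hx) (h.symm.left_subset hG₂)
    hcard ?_
  by_contra hxG
  exact hG₁ (mem_chains.1 hx.1 G hxG).1

theorem exists_bounding_chain (h : IsDecomposition L L₁ L₂ M) (hL : L.IsHomologySphere k)
    (hr : M.rank + 1 = L.rank) :
    ∃ y ∈ L₁.chains k L.dim, boundary k y ∈ M.cycles k M.dim ∧ boundary k y ≠ 0 := by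
  obtain ⟨z, hz, hz₀⟩ := hL.exists_mem_cycles_ne_zero
  obtain ⟨y₁, hy₁, y₂, hy₂, rfl⟩ := h.exists_add_eq hz.1
  have hboundary : boundary k y₁ = -boundary k y₂ :=
    eq_neg_of_add_eq_zero_left (by rw [← map_add]; exact hz.2)
  refine ⟨y₁, hy₁, mem_cycles.2 ⟨?_, boundary_boundary k y₁⟩, fun hzero => hz₀ ?_⟩
  · rw [← dim_add_one_eq_dim_iff.2 hr] at hy₁ hy₂
    refine h.mem_chains_inter (boundary_mem_chains hy₁) ?_
    rw [hboundary]
    exact neg_mem (boundary_mem_chains hy₂)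
  · have hy₁₀ : y₁ = 0 := h.eq_zero_of_mem_cycles_left hL ⟨hy₁, hzero⟩
    have hy₂₀ : y₂ = 0 :=
      h.symm.eq_zero_of_mem_cycles_left hL ⟨hy₂, neg_eq_zero.1 (hboundary.symm.trans hzero)⟩
    simp [hy₁₀, hy₂₀]

theorem exists_superset (h : IsDecomposition L L₁ L₂ M) (hL : L.IsHomologySphere k)
    (hM : M.IsHomologySphere k) (hr : M.rank + 1 = L.rank) (hF : F ∈ M.faces) :
    ∃ G ∈ L₁.faces, G ∉ L₂.faces ∧ F ⊆ G := by
  obtain ⟨y, hy, hcycle, hne⟩ := h.exists_bounding_chain hL hr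
  obtain ⟨R, hR, hFR, hcard⟩ := hM.exists_facet hF
  have hR₀ : boundary k y R ≠ 0 := fun hzero =>
    hne (hM.eq_zero_of_apply_eq_zero hcycle hR hcard hzero)
  obtain ⟨v, -, hv⟩ : ∃ v ∉ R, y (insert v R) ≠ 0 := by
    by_contra! hzero
    exact hR₀ (boundary_apply_eq_zero hzero)
  obtain ⟨hmem, hfull⟩ := mem_chains.1 hy _ hv
  refine ⟨insert v R, hmem, fun hmem₂ => ?_, hFR.trans (Finset.subset_insert v R)⟩
  have := card_le_rank (h.mem_inter hmem hmem₂)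
  rw [dim] at hfull
  omega

theorem exists_mem_link_left (h : IsDecomposition L L₁ L₂ M) (hL : L.IsHomologySphere k)
    (hM : M.IsHomologySphere k) (hr : M.rank + 1 = L.rank) (hF : F ∈ M.faces) :
    ∃ G ∈ (L₁.link F (h.inter_subset_left hF)).faces,
      G ∉ (L₂.link F (h.symm.inter_subset_left hF)).faces := by
  obtain ⟨G, hG₁, hG₂, hFG⟩ := h.exists_superset hL hM hr hF
  refine ⟨G \ F, mem_link.2 ⟨Finset.disjoint_sdiff, ?_⟩, fun hG => hG₂ ?_⟩
  · rwa [Finset.union_sdiff_of_subset hFG]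
  · rw [← Finset.union_sdiff_of_subset hFG]
    exact (mem_link.1 hG).2

theorem link (h : IsDecomposition L L₁ L₂ M) (hL : L.IsHomologySphere k)
    (hM : M.IsHomologySphere k) (hr : M.rank + 1 = L.rank) (hF : F ∈ M.faces) :
    IsDecomposition (L.link F (h.left_subset (h.inter_subset_left hF)))
      (L₁.link F (h.inter_subset_left hF)) (L₂.link F (h.symm.inter_subset_left hF))
      (M.link F hF) where
  union := by
    ext G
    simp only [Finset.mem_union, mem_link, h.union, ← and_or_left]
  inter := by
    ext G
    simp only [Finset.mem_inter, mem_link, h.inter, ← and_and_left]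
  left := h.exists_mem_link_left hL hM hr hF
  right := h.symm.exists_mem_link_left hL hM hr hF

theorem cycles_le_boundaries_left (h : IsDecomposition L L₁ L₂ M) (hL : L.IsHomologySphere k)
    (hM : M.IsHomologySphere k) (hr : M.rank + 1 = L.rank) (i : ℤ) :
    L₁.cycles k i ≤ L₁.boundaries k i := by
  intro x hx
  rcases eq_or_ne i L.dim with rfl | hi
  · rw [h.eq_zero_of_mem_cycles_left hL hx]
    exact zero_mem _
  obtain ⟨y, hy, hyx⟩ := hL.cycles_le_boundaries hi (cycles_mono h.left_subset i hx)
  obtain ⟨y₁, hy₁, y₂, hy₂, rfl⟩ := h.exists_add_eq hy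
  suffices hbound : boundary k y₂ ∈ L₁.boundaries k i by
    rw [← hyx, map_add]
    exact add_mem ⟨y₁, hy₁, rfl⟩ hbound
  have hcycle : boundary k y₂ ∈ M.cycles k i := by
    refine mem_cycles.2 ⟨h.mem_chains_inter ?_ (boundary_mem_chains hy₂), boundary_boundary k y₂⟩
    rw [map_add] at hyx
    rw [eq_sub_of_add_eq' hyx]
    exact sub_mem hx.1 (boundary_mem_chains hy₁)
  rcases eq_or_ne i M.dim with rfl | hi'
  · obtain ⟨w, hw, hwcycle, hw₀⟩ := h.exists_bounding_chain hL hr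
    obtain ⟨a, ha⟩ := hM.exists_smul_eq hwcycle hw₀ hcycle
    rw [← ha, ← map_smul]
    exact ⟨a • w, Submodule.smul_mem _ _ (dim_add_one_eq_dim_iff.2 hr ▸ hw), rfl⟩
  · obtain ⟨m, hm, hmy⟩ := hM.cycles_le_boundaries hi' hcycle
    exact ⟨m, chains_mono h.inter_subset_left _ hm, hmy⟩

theorem isHomologyBall_left (h : IsDecomposition L L₁ L₂ M) (hL : L.IsHomologySphere k)
    (hM : M.IsHomologySphere k) (hr : M.rank + 1 = L.rank) : L₁.IsHomologyBall k M := by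
  refine isHomologyBall_iff.2 ⟨h.inter_subset_left, hM, hr.trans (h.rank_left hL).symm,
    fun F hF => ⟨fun hFM i => subsingleton_reducedHomology.2 ?_, fun hFM => ?_⟩⟩
  · refine (h.link hL hM hr hFM).cycles_le_boundaries_left (hL.link _) (hM.link hFM) ?_ i
    have := hL.rank_link (h.left_subset hF)
    have := hM.rank_link hFM
    omega
  · rw [h.link_left_eq hF hFM]
    exact hL.hasSphereHomology_link _

end IsDecomposition

section Separation

theorem IsInducedSubcomplex.exists_singleton_notMem {V : Type*} {Γ Δ : FiniteComplex V}
    {F : Finset V} (h : Γ.IsInducedSubcomplex Δ) (hF : F ∈ Δ.faces) (hcard : Γ.rank < F.card) :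
    ∃ v ∈ F, {v} ∉ Γ.faces := by
  by_contra! hvertices
  exact hcard.not_ge (card_le_rank (h.2 F hF hvertices))

theorem IsInducedSubcomplex.isDecomposition_restrict {V : Type*} [DecidableEq V]
    {Γ Δ : FiniteComplex V} (h : Γ.IsInducedSubcomplex Δ) {S : Set V}
    (hS : ∀ a b, a ≠ b → {a, b} ∈ Δ.faces → {b} ∉ Γ.faces → a ∈ S → b ∈ S)
    {u w : V} (hu : {u} ∈ Δ.faces) (huΓ : {u} ∉ Γ.faces) (huS : u ∈ S) (hw : {w} ∈ Δ.faces)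
    (hwΓ : {w} ∉ Γ.faces) (hwS : w ∉ S) :
    IsDecomposition Δ (Δ.restrict {v | {v} ∈ Γ.faces ∨ v ∈ S})
      (Δ.restrict {v | {v} ∈ Γ.faces ∨ v ∉ S}) Γ where
  union := by
    ext F
    simp only [Finset.mem_union, mem_restrict, ← and_or_left, iff_self_and, Set.mem_ofPred_eq]
    intro hF
    by_contra! hmixed
    obtain ⟨⟨b, hbF, hbΓ, hbS⟩, a, haF, -, haS⟩ := hmixed
    have hab : a ≠ b := fun hab => hbS (hab ▸ haS)
    exact hbS (hS a b hab (Δ.down_closed hF (by simp [Finset.insert_subset_iff, haF, hbF])) hbΓ haS)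
  inter := by
    ext F
    simp only [Finset.mem_inter, mem_restrict, Set.mem_ofPred_eq]
    constructor
    · intro hF
      have hvertices : ∀ v ∈ F, {v} ∈ Γ.faces := fun v hv => singleton_mem hF hv
      exact ⟨⟨h.1 hF, fun v hv => Or.inl (hvertices v hv)⟩, h.1 hF,
        fun v hv => Or.inl (hvertices v hv)⟩
    · rintro ⟨⟨hF, hF₁⟩, -, hF₂⟩
      refine h.2 F hF fun v hv => ?_
      have := hF₁ v hv
      have := hF₂ v hv
      tauto
  left := ⟨{u}, by simp [mem_restrict, hu, huS], by simp [mem_restrict, huΓ, huS]⟩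
  right := ⟨{w}, by simp [mem_restrict, hw, hwS], by simp [mem_restrict, hwΓ, hwS]⟩

variable {V : Type*} [LinearOrder V] {k : Type*} [Field k] {Γ Δ : FiniteComplex V}
  {c : Finset V →₀ k}

theorem contract_eq_zero_of_mem_chains {i : ℤ} (hc : c ∈ Γ.chains k i) {v : V}
    (hv : {v} ∉ Γ.faces) : contract k v c = 0 := by
  refine contract_eq_zero_iff.2 fun F hvF => ?_
  by_contra hcF
  exact hv (singleton_mem (mem_chains.1 hc F hcF).1 hvF)

theorem IsInducedSubcomplex.eq_zero_of_forall_contract_eq_zero (h : Γ.IsInducedSubcomplex Δ)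
    {i : ℤ} (hi : Γ.dim < i) (hc : c ∈ Δ.chains k i)
    (hcontract : ∀ v, {v} ∈ Δ.faces → {v} ∉ Γ.faces → contract k v c = 0) : c = 0 := by
  ext F
  by_contra hcF
  obtain ⟨hF, hcard⟩ := mem_chains.1 hc F hcF
  obtain ⟨v, hvF, hv⟩ := h.exists_singleton_notMem hF (by rw [dim] at hi; omega)
  exact hcF (contract_eq_zero_iff.1
    (hcontract v (singleton_mem hF hvF) hv) F hvF)

theorem IsHomologySphere.contract_mem_cycles_of_contract_boundary (hΔ : Δ.IsHomologySphere k)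
    (hc : c ∈ Δ.chains k Δ.dim) {v : V} (hv : {v} ∈ Δ.faces)
    (hcycle : contract k v (boundary k c) = 0) :
    contract k v c ∈ (Δ.link {v} hv).cycles k (Δ.link {v} hv).dim := by
  rw [← hΔ.dim_link_singleton hv] at hc
  exact mem_cycles.2 ⟨contract_mem_chains hv hc, by
    rwa [contract_boundary, neg_eq_zero] at hcycle⟩

theorem IsHomologySphere.contract_eq_zero_of_edge (hΔ : Δ.IsHomologySphere k)
    (hc : c ∈ Δ.chains k Δ.dim) {a b : V} (hab : a ≠ b) (hedge : {a, b} ∈ Δ.faces)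
    (hb : contract k b (boundary k c) = 0) (ha : contract k a c = 0) : contract k b c = 0 := by
  have hbΔ : {b} ∈ Δ.faces := Δ.down_closed hedge (by simp)
  refine (hΔ.link hbΔ).eq_zero_of_contract_eq_zero
    (hΔ.contract_mem_cycles_of_contract_boundary hc hbΔ hb)
    (singleton_mem_link_singleton.2 ⟨hab.symm, by rwa [Finset.pair_comm]⟩) ?_
  refine contract_eq_zero_iff.2 fun F haF => ?_
  rw [contract_apply, contract_eq_zero_iff.1 ha _ (Finset.mem_insert_of_mem haF), mul_zero,
    ite_self]

theorem IsHomologySphere.exists_bounding_chain_contract_eq_zero (hΔ : Δ.IsHomologySphere k)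
    (hΓ : Γ.IsHomologySphere k) (hr : Γ.rank + 1 = Δ.rank) (hΓΔ : Γ.faces ⊆ Δ.faces) {u : V}
    (hu : {u} ∈ Δ.faces) (huΓ : {u} ∉ Γ.faces) :
    ∃ c ∈ Δ.chains k Δ.dim, boundary k c ∈ Γ.cycles k Γ.dim ∧ boundary k c ≠ 0 ∧
      contract k u c = 0 := by
  have hdim := dim_add_one_eq_dim_iff.2 hr
  obtain ⟨z, hz, hz₀⟩ := hΔ.exists_mem_cycles_ne_zero
  obtain ⟨ω, hω, hω₀⟩ := hΓ.exists_mem_cycles_ne_zero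
  obtain ⟨c, hc, rfl⟩ := hΔ.cycles_le_boundaries (by omega) (cycles_mono hΓΔ _ hω)
  rw [hdim] at hc
  obtain ⟨a, ha⟩ := (hΔ.link hu).exists_smul_eq (hΔ.contract_mem_cycles_dim hz hu)
    (fun hzero => hz₀ (hΔ.eq_zero_of_contract_eq_zero hz hu hzero))
    (hΔ.contract_mem_cycles_of_contract_boundary hc hu (contract_eq_zero_of_mem_chains hω.1 huΓ))
  have hboundary : boundary k (c - a • z) = boundary k c := by
    rw [map_sub, map_smul, (mem_cycles.1 hz).2, smul_zero, sub_zero]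
  refine ⟨c - a • z, sub_mem hc (Submodule.smul_mem _ a hz.1), ?_, ?_, ?_⟩
  · rwa [hboundary]
  · rwa [hboundary]
  · rw [map_sub, map_smul, ha, sub_self]

/-- Jordan separation: a chain `c` that bounds the fundamental cycle of `Γ` and vanishes on the star
of `u` vanishes on the stars of exactly those vertices outside `Γ` that are on the side of `u`. -/
theorem IsHomologySphere.exists_isDecomposition_restrict (hΔ : Δ.IsHomologySphere k)
    (hΓ : Γ.IsHomologySphere k) (hr : Γ.rank + 1 = Δ.rank) (hΓΔ : Γ.IsInducedSubcomplex Δ) :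
    ∃ S₁ S₂ : Set V, IsDecomposition Δ (Δ.restrict S₁) (Δ.restrict S₂) Γ := by
  obtain ⟨F, hF, hcard⟩ := Δ.exists_card_eq_rank
  obtain ⟨u, huF, huΓ⟩ := hΓΔ.exists_singleton_notMem hF (by omega)
  have hu : {u} ∈ Δ.faces := singleton_mem hF huF
  obtain ⟨c, hc, hcΓ, hc₀, hcu⟩ :=
    hΔ.exists_bounding_chain_contract_eq_zero hΓ hr hΓΔ.1 hu huΓ
  obtain ⟨w, hw, hwΓ, hcw⟩ : ∃ w, {w} ∈ Δ.faces ∧ {w} ∉ Γ.faces ∧ contract k w c ≠ 0 := by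
    by_contra! hzero
    refine hc₀ ?_
    rw [hΓΔ.eq_zero_of_forall_contract_eq_zero (by rw [dim, dim]; omega) hc hzero, map_zero]
  exact ⟨_, _, hΓΔ.isDecomposition_restrict (S := {v | contract k v c = 0})
    (fun a b hab hedge hb ha => hΔ.contract_eq_zero_of_edge hc hab hedge
      (contract_eq_zero_of_mem_chains hcΓ.1 hb) ha) hu huΓ hcu hw hwΓ hcw⟩

end Separation

section Deletion

section

variable {V : Type*} {Δ : FiniteComplex V} {F G : Finset V} {v : V}

/-- The subcomplex of the faces of `Δ` that do not contain `v`. -/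
noncomputable def deletion (Δ : FiniteComplex V) (v : V) : FiniteComplex V := Δ.restrict {v}ᶜ

theorem mem_deletion : F ∈ (Δ.deletion v).faces ↔ F ∈ Δ.faces ∧ v ∉ F := by
  rw [deletion, mem_restrict, and_congr_right_iff]
  exact fun _ => ⟨fun h hv => h v hv rfl, fun h w hw hwv => h (hwv ▸ hw)⟩

theorem deletion_eq_self (hv : {v} ∉ Δ.faces) : Δ.deletion v = Δ := by
  ext F
  rw [mem_deletion, and_iff_left_iff_imp]
  exact fun hF hvF => hv (singleton_mem hF hvF)

variable [DecidableEq V]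

theorem link_deletion (hF : F ∈ (Δ.deletion v).faces) :
    (Δ.deletion v).link F hF = (Δ.link F (mem_deletion.1 hF).1).deletion v := by
  ext G
  have := (mem_deletion.1 hF).2
  simp only [mem_link, mem_deletion, Finset.mem_union]
  tauto

theorem link_link_comm {hF : F ∈ Δ.faces} {hG : G ∈ (Δ.link F hF).faces} {hG' : G ∈ Δ.faces}
    {hF' : F ∈ (Δ.link G hG').faces} :
    (Δ.link F hF).link G hG = (Δ.link G hG').link F hF' := by
  ext H
  simp only [mem_link, Finset.disjoint_union_right, Finset.union_left_comm F G]
  tauto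

theorem rank_eq_rank_link_add_one {hv : {v} ∈ Δ.faces}
    (h : (Δ.deletion v).rank ≤ (Δ.link {v} hv).rank + 1) :
    Δ.rank = (Δ.link {v} hv).rank + 1 := by
  refine (Finset.sup_le fun F hF => ?_).antisymm
    (show _ ≤ Δ.rank from Finset.card_singleton v ▸ rank_link_add_card_le hv)
  by_cases hvF : v ∈ F
  · rw [← Finset.card_erase_add_one hvF]
    exact Nat.add_le_add_right (card_le_rank (erase_mem_link_singleton hvF hF)) 1
  · exact (card_le_rank (mem_deletion.2 ⟨hF, hvF⟩)).trans h

end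

variable {V : Type*} [LinearOrder V] {k : Type*} [Field k] {Δ : FiniteComplex V} {v : V} {i : ℤ}

theorem mem_chains_deletion_iff {c : Finset V →₀ k} :
    c ∈ (Δ.deletion v).chains k i ↔ c ∈ Δ.chains k i ∧ contract k v c = 0 := by
  simp only [mem_chains, mem_deletion, contract_eq_zero_iff, ← forall_and]
  exact forall_congr' fun F => by tauto

theorem chains_link_le_map_contract (hv : {v} ∈ Δ.faces) :
    (Δ.link {v} hv).chains k i ≤ (Δ.chains k (i + 1)).map (contract k v) := by
  rw [chains, Finsupp.supported_eq_span_single, Submodule.span_le]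
  rintro _ ⟨G, ⟨hG, hcard⟩, rfl⟩
  obtain ⟨hvG, hmem⟩ := mem_link_singleton.1 hG
  refine ⟨Finsupp.single (insert v G) (incidence k v (insert v G))⁻¹,
    single_mem_chains hmem ?_ _, ?_⟩
  · rw [Finset.card_insert_of_notMem hvG]
    push_cast
    omega
  · rw [contract_single, if_pos (Finset.mem_insert_self v G), Finset.erase_insert hvG, smul_smul,
      inv_mul_cancel₀ (incidence_ne_zero k v _), one_smul]

theorem cycles_link_le_map_contract (hv : {v} ∈ Δ.faces) (h : (Δ.deletion v).IsAcyclic k) :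
    (Δ.link {v} hv).cycles k i ≤ (Δ.cycles k (i + 1)).map (contract k v) := by
  intro x hx
  obtain ⟨c, hc, rfl⟩ := chains_link_le_map_contract hv hx.1
  have hcycle : boundary k c ∈ (Δ.deletion v).cycles k i := by
    refine mem_cycles.2 ⟨mem_chains_deletion_iff.2 ⟨boundary_mem_chains hc, ?_⟩,
      boundary_boundary k c⟩
    rw [contract_boundary, (mem_cycles.1 hx).2, neg_zero]
  obtain ⟨y, hy, hyc⟩ := subsingleton_reducedHomology.1 (h i) hcycle
  obtain ⟨hyΔ, hyv⟩ := mem_chains_deletion_iff.1 hy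
  exact ⟨c - y, mem_cycles.2 ⟨sub_mem hc hyΔ, by rw [map_sub, hyc, sub_self]⟩,
    by rw [map_sub, hyv, sub_zero]⟩

theorem contract_mem_boundaries_iff (hv : {v} ∈ Δ.faces) (h : (Δ.deletion v).IsAcyclic k)
    {c : Finset V →₀ k} (hc : c ∈ Δ.cycles k i) {j : ℤ} (hij : j + 1 = i) :
    contract k v c ∈ (Δ.link {v} hv).boundaries k j ↔ c ∈ Δ.boundaries k i := by
  subst hij
  constructor
  · rintro ⟨_, hx, hxc⟩
    obtain ⟨b, hb, rfl⟩ := chains_link_le_map_contract hv hx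
    have hcycle : c + boundary k b ∈ (Δ.deletion v).cycles k (j + 1) := by
      rw [mem_cycles, mem_chains_deletion_iff]
      refine ⟨⟨add_mem hc.1 (boundary_mem_chains hb), ?_⟩, ?_⟩
      · rw [map_add, contract_boundary, hxc, add_neg_cancel]
      · rw [map_add, (mem_cycles.1 hc).2, boundary_boundary, add_zero]
    obtain ⟨y, hy, hyc⟩ := subsingleton_reducedHomology.1 (h (j + 1)) hcycle
    exact ⟨y - b, sub_mem (mem_chains_deletion_iff.1 hy).1 hb, by
      rw [map_sub, hyc, add_sub_cancel_right]⟩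
  · rintro ⟨b, hb, rfl⟩
    exact ⟨-contract k v b, neg_mem (contract_mem_chains hv hb), by
      rw [map_neg, contract_boundary]⟩

theorem nonempty_reducedHomology_equiv_link (hv : {v} ∈ Δ.faces)
    (h : (Δ.deletion v).IsAcyclic k) (i : ℤ) :
    Nonempty (Δ.ReducedHomology k (i + 1) ≃ₗ[k] (Δ.link {v} hv).ReducedHomology k i) := by
  let φ : Δ.cycles k (i + 1) →ₗ[k] (Δ.link {v} hv).ReducedHomology k i :=
    Submodule.mkQ _ ∘ₗ (contract k v).restrict fun _ hc => contract_mem_cycles hv hc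
  have hsurj : Function.Surjective φ := by
    refine (Submodule.mkQ_surjective _).comp ?_
    rintro ⟨x, hx⟩
    obtain ⟨c, hc, rfl⟩ := cycles_link_le_map_contract hv h hx
    exact ⟨⟨c, hc⟩, rfl⟩
  have hker : LinearMap.ker φ = (Δ.boundaries k (i + 1)).submoduleOf (Δ.cycles k (i + 1)) := by
    ext ⟨c, hc⟩
    rw [LinearMap.ker_comp, Submodule.ker_mkQ]
    exact contract_mem_boundaries_iff hv h hc rfl
  exact ⟨(Submodule.quotEquivOfEq _ _ hker.symm).trans (φ.quotKerEquivOfSurjective hsurj)⟩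

theorem HasSphereHomology.of_isAcyclic_deletion {hv : {v} ∈ Δ.faces}
    (hlink : (Δ.link {v} hv).HasSphereHomology k) (h : (Δ.deletion v).IsAcyclic k)
    (hr : (Δ.deletion v).rank ≤ (Δ.link {v} hv).rank + 1) : Δ.HasSphereHomology k := by
  have hdim : (Δ.link {v} hv).dim + 1 = Δ.dim :=
    dim_add_one_eq_dim_iff.2 (rank_eq_rank_link_add_one hr).symm
  intro j
  obtain ⟨i, rfl⟩ : ∃ i, i + 1 = j := ⟨j - 1, sub_add_cancel j 1⟩
  obtain ⟨e⟩ := nonempty_reducedHomology_equiv_link hv h i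
  rw [← hdim, Ne, add_left_inj]
  exact ⟨fun hi => ((hlink i).1 hi).map e.trans, fun hi => have := (hlink i).2 hi; e.subsingleton⟩

theorem IsHomologyBall.rank_add_one {B : FiniteComplex V} (h : Δ.IsHomologyBall k B) :
    B.rank + 1 = Δ.rank :=
  (isHomologyBall_iff.1 h).2.2.1

theorem IsHomologyBall.isHomologySphere_of_deletion {hv : {v} ∈ Δ.faces}
    (h : (Δ.deletion v).IsHomologyBall k (Δ.link {v} hv)) : Δ.IsHomologySphere k := by
  obtain ⟨-, hsphere, hr, hball⟩ := isHomologyBall_iff.1 h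
  intro F hF
  by_cases hvF : v ∈ F
  · have hlink := hsphere.hasSphereHomology_link (erase_mem_link_singleton hvF hF)
    simp only [link_link, Finset.singleton_union, Finset.insert_erase hvF] at hlink
    exact hlink
  have hFdel : F ∈ (Δ.deletion v).faces := mem_deletion.2 ⟨hF, hvF⟩
  by_cases hFlink : F ∈ (Δ.link {v} hv).faces
  · have hvlink : {v} ∈ (Δ.link F hF).faces := by
      rw [mem_link, disjoint_comm, Finset.union_comm, ← mem_link (hF := hv)]
      exact hFlink
    have hcomm : (Δ.link F hF).link {v} hvlink = (Δ.link {v} hv).link F hFlink := link_link_comm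
    refine HasSphereHomology.of_isAcyclic_deletion (hv := hvlink) ?_ ?_ ?_
    · rw [hcomm]
      exact hsphere.hasSphereHomology_link hFlink
    · rw [← link_deletion hFdel]
      exact (hball F hFdel).1 hFlink
    · have hle := rank_link_add_card_le hFdel
      have := hsphere.rank_link hFlink
      rw [link_deletion hFdel] at hle
      rw [hcomm]
      omega
  · have hsame : (Δ.link F hF).deletion v = Δ.link F hF := by
      refine deletion_eq_self fun hvlink => hFlink ?_
      rw [mem_link, disjoint_comm, Finset.union_comm, ← mem_link (hF := hF)]
      exact hvlink
    have hlink := (hball F hFdel).2 hFlink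
    rwa [link_deletion hFdel, hsame] at hlink

end Deletion

section Map

section

variable {V W : Type*} {Γ Δ : FiniteComplex V} {F : Finset V} {f : V ↪ W}

/-- The complex `Δ` with its ground set relabelled along an injection `f`. -/
def map (f : V ↪ W) (Δ : FiniteComplex V) : FiniteComplex W where
  faces := Δ.faces.map (Finset.mapEmbedding f).toEmbedding
  empty_mem := Finset.mem_map.2 ⟨∅, Δ.empty_mem, Finset.map_empty f⟩
  down_closed hG hFG := by
    obtain ⟨G', hG', rfl⟩ := Finset.mem_map.1 hG
    obtain ⟨F', hF', rfl⟩ := Finset.subset_map_iff.1 hFG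
    exact Finset.mem_map_of_mem _ (Δ.down_closed hG' hF')

theorem mem_map {F : Finset W} : F ∈ (Δ.map f).faces ↔ ∃ G ∈ Δ.faces, G.map f = F :=
  Finset.mem_map

theorem map_mem_map : F.map f ∈ (Δ.map f).faces ↔ F ∈ Δ.faces :=
  Finset.mem_map' _

theorem singleton_notMem_map {w : W} (hw : w ∉ Set.range f) : {w} ∉ (Δ.map f).faces := fun h => by
  obtain ⟨G, -, hG⟩ := mem_map.1 h
  obtain ⟨v, -, hv⟩ := Finset.mem_map.1 (hG ▸ Finset.mem_singleton_self w)
  exact hw ⟨v, hv⟩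

theorem map_subset_map (h : Γ.faces ⊆ Δ.faces) : (Γ.map f).faces ⊆ (Δ.map f).faces :=
  Finset.map_subset_map.2 h

theorem rank_map (f : V ↪ W) (Δ : FiniteComplex V) : (Δ.map f).rank = Δ.rank := by
  simp only [rank, map, Finset.sup_map, Function.comp_def, RelEmbedding.coe_toEmbedding,
    Finset.mapEmbedding_apply, Finset.card_map]

theorem faceCount_map (f : V ↪ W) (Δ : FiniteComplex V) (i : ℕ) :
    (Δ.map f).faceCount i = Δ.faceCount i := by
  simp only [faceCount, map, Finset.filter_map, Function.comp_def, RelEmbedding.coe_toEmbedding,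
    Finset.mapEmbedding_apply, Finset.card_map]

theorem hPoly_map (f : V ↪ W) (Δ : FiniteComplex V) : (Δ.map f).hPoly = Δ.hPoly := by
  simp only [hPoly, rank_map, faceCount_map]

theorem thetaPoly_map (f : V ↪ W) (Δ Γ : FiniteComplex V) :
    thetaPoly (Δ.map f) (Γ.map f) = thetaPoly Δ Γ := by
  rw [thetaPoly, thetaPoly, hPoly_map, hPoly_map]

theorem singleton_map_mem_map {v : V} : {f v} ∈ (Δ.map f).faces ↔ {v} ∈ Δ.faces := by
  rw [← Finset.map_singleton, map_mem_map]

theorem IsInducedSubcomplex.map (h : Γ.IsInducedSubcomplex Δ) (f : V ↪ W) :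
    (Γ.map f).IsInducedSubcomplex (Δ.map f) := by
  refine ⟨map_subset_map h.1, fun F hF hvert => ?_⟩
  obtain ⟨G, hG, rfl⟩ := mem_map.1 hF
  rw [Finset.forall_mem_map] at hvert
  exact map_mem_map.2 (h.2 G hG fun v hv => singleton_map_mem_map.1 (hvert v hv))

variable [DecidableEq V] [DecidableEq W]

theorem IsFlag.map (h : Δ.IsFlag) (f : V ↪ W) : (Δ.map f).IsFlag := by
  intro F hF
  have hrange : (F : Set W) ⊆ Set.range f := fun u hu => by
    obtain ⟨G, -, hG⟩ := mem_map.1 (hF u hu u hu)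
    obtain ⟨v, -, hv⟩ := Finset.mem_map.1 (hG ▸ Finset.mem_insert_self u {u})
    exact ⟨v, hv⟩
  obtain ⟨G, rfl⟩ : ∃ G : Finset V, G.map f = F := by
    obtain ⟨G, -, hG⟩ := Finset.subset_set_image_iff.1 (Set.image_univ ▸ hrange)
    exact ⟨G, by rwa [Finset.map_eq_image]⟩
  refine map_mem_map.2 (h G fun u hu v hv => (map_mem_map (f := f)).1 ?_)
  rw [Finset.map_insert, Finset.map_singleton]
  exact hF _ (Finset.mem_map_of_mem f hu) _ (Finset.mem_map_of_mem f hv)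

theorem link_map (hF : F ∈ Δ.faces) :
    (Δ.map f).link (F.map f) (map_mem_map.2 hF) = (Δ.link F hF).map f := by
  ext G
  constructor
  · intro hG
    obtain ⟨G, -, rfl⟩ := mem_map.1 (link_subset _ hG)
    rwa [mem_link, Finset.disjoint_map, ← Finset.map_union, map_mem_map, ← mem_link (hF := hF),
      ← map_mem_map (f := f)] at hG
  · intro hG
    obtain ⟨G, hG, rfl⟩ := mem_map.1 hG
    rwa [mem_link, Finset.disjoint_map, ← Finset.map_union, map_mem_map, ← mem_link (hF := hF)]

end

variable {V W : Type*} [LinearOrder V] [LinearOrder W] {k : Type*} [Field k]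
  {B Δ : FiniteComplex V}

variable (k) in
/-- The linear map on formal combinations of simplices that relabels the vertices along `f`. -/
noncomputable def mapChains (f : V ↪o W) : (Finset V →₀ k) →ₗ[k] (Finset W →₀ k) :=
  Finsupp.lmapDomain k k (Finset.map f.toEmbedding)

theorem mapChains_injective (f : V ↪o W) : Function.Injective (mapChains k f) :=
  Finsupp.mapDomain_injective (Finset.map_injective _)

theorem incidence_map (f : V ↪o W) (v : V) (F : Finset V) :
    incidence k (f v) (F.map f.toEmbedding) = incidence k v F := by
  simp [incidence, Finset.filter_map]

theorem boundary_comp_mapChains (f : V ↪o W) :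
    boundary k ∘ₗ mapChains k f = mapChains k f ∘ₗ boundary k := by
  have hsingle (G : Finset V) (b : k) : mapChains k f (Finsupp.single G b) =
      Finsupp.single (G.map f.toEmbedding) b := Finsupp.mapDomain_single
  refine Finsupp.lhom_ext fun F a => ?_
  simp only [LinearMap.comp_apply, hsingle, boundary_single, map_smul, map_sum, Finset.sum_map,
    Finset.map_erase, ← incidence_map f, RelEmbedding.coe_toEmbedding]

theorem chains_map (f : V ↪o W) (Δ : FiniteComplex V) (i : ℤ) :
    (Δ.map f.toEmbedding).chains k i = (Δ.chains k i).map (mapChains k f) := by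
  rw [chains, chains, mapChains, Finsupp.lmapDomain_supported]
  congr 1
  ext F
  constructor
  · rintro ⟨hF, hcard⟩
    obtain ⟨G, hG, rfl⟩ := mem_map.1 hF
    exact ⟨G, ⟨hG, Finset.card_map f.toEmbedding ▸ hcard⟩, rfl⟩
  · rintro ⟨G, ⟨hG, hcard⟩, rfl⟩
    exact ⟨map_mem_map.2 hG, (Finset.card_map f.toEmbedding).symm ▸ hcard⟩

theorem cycles_map (f : V ↪o W) (Δ : FiniteComplex V) (i : ℤ) :
    (Δ.map f.toEmbedding).cycles k i = (Δ.cycles k i).map (mapChains k f) := by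
  rw [cycles, cycles, chains_map, Submodule.map_inf_eq_map_inf_comap, ← LinearMap.ker_comp,
    boundary_comp_mapChains, LinearMap.ker_comp_of_ker_eq_bot _
      (LinearMap.ker_eq_bot.2 (mapChains_injective f))]

theorem boundaries_map (f : V ↪o W) (Δ : FiniteComplex V) (i : ℤ) :
    (Δ.map f.toEmbedding).boundaries k i = (Δ.boundaries k i).map (mapChains k f) := by
  rw [boundaries, boundaries, chains_map, ← Submodule.map_comp, ← Submodule.map_comp,
    boundary_comp_mapChains]

theorem nonempty_reducedHomology_map_equiv (f : V ↪o W) (Δ : FiniteComplex V) (i : ℤ) :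
    Nonempty ((Δ.map f.toEmbedding).ReducedHomology k i ≃ₗ[k] Δ.ReducedHomology k i) := by
  let e : Δ.cycles k i ≃ₗ[k] (Δ.map f.toEmbedding).cycles k i :=
    (Submodule.equivMapOfInjective _ (mapChains_injective f) _).trans
      (LinearEquiv.ofEq _ _ (cycles_map f Δ i).symm)
  refine ⟨(Submodule.Quotient.equiv _ _ e ?_).symm⟩
  ext x
  obtain ⟨y, rfl⟩ := e.surjective x
  rw [Submodule.mem_map_equiv, e.symm_apply_apply, Submodule.submoduleOf, Submodule.submoduleOf,
    boundaries_map]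
  exact ((mapChains_injective f).mem_set_image (s := (Δ.boundaries k i : Set (Finset V →₀ k)))).symm

theorem IsAcyclic.map (h : Δ.IsAcyclic k) (f : V ↪o W) :
    (Δ.map f.toEmbedding).IsAcyclic k := fun i => by
  obtain ⟨e⟩ := nonempty_reducedHomology_map_equiv (k := k) f Δ i
  have := h i
  exact e.subsingleton

theorem HasSphereHomology.map (h : Δ.HasSphereHomology k) (f : V ↪o W) :
    (Δ.map f.toEmbedding).HasSphereHomology k := fun i => by
  obtain ⟨e⟩ := nonempty_reducedHomology_map_equiv (k := k) f Δ i
  rw [dim, rank_map, ← dim]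
  exact ⟨fun hi => ((h i).1 hi).map e.trans, fun hi => have := (h i).2 hi; e.subsingleton⟩

theorem IsHomologySphere.map (h : Δ.IsHomologySphere k) (f : V ↪o W) :
    (Δ.map f.toEmbedding).IsHomologySphere k := by
  intro F hF
  obtain ⟨G, hG, rfl⟩ := mem_map.1 hF
  have hlink := (h.hasSphereHomology_link hG).map f
  rwa [← link_map hG] at hlink

theorem IsHomologyBall.map (h : Δ.IsHomologyBall k B) (f : V ↪o W) :
    (Δ.map f.toEmbedding).IsHomologyBall k (B.map f.toEmbedding) := by
  obtain ⟨hB, hsphere, hr, hball⟩ := isHomologyBall_iff.1 h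
  refine isHomologyBall_iff.2 ⟨map_subset_map hB, hsphere.map f, by rwa [rank_map, rank_map],
    fun F hF => ?_⟩
  obtain ⟨G, hG, rfl⟩ := mem_map.1 hF
  rw [map_mem_map, link_map hG]
  exact ⟨fun hGB => ((hball G hG).1 hGB).map f, fun hGB => ((hball G hG).2 hGB).map f⟩

end Map

section Cone

variable {V : Type*} [DecidableEq V] {B Δ : FiniteComplex V} {hB : B.faces ⊆ Δ.faces}
  {F : Finset V} {p : V}

/-- The complex obtained from `Δ` by attaching the cone with apex `p` over a subcomplex `B`. It is
meant for points `p` that are not vertices of `Δ`. -/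
def coneOff (Δ B : FiniteComplex V) (hB : B.faces ⊆ Δ.faces) (p : V) : FiniteComplex V where
  faces := Δ.faces ∪ B.faces.image (insert p)
  empty_mem := Finset.mem_union_left _ Δ.empty_mem
  down_closed {F G} hG hFG := by
    rw [Finset.mem_union, Finset.mem_image] at hG ⊢
    obtain hG | ⟨H, hH, rfl⟩ := hG
    · exact .inl (Δ.down_closed hG hFG)
    by_cases hp : p ∈ F
    · exact .inr ⟨F.erase p, B.down_closed hH (Finset.subset_insert_iff.1 hFG),
        Finset.insert_erase hp⟩
    · exact .inl (hB (B.down_closed hH ((Finset.subset_insert_iff_of_notMem hp).1 hFG)))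

theorem mem_coneOff : F ∈ (Δ.coneOff B hB p).faces ↔ F ∈ Δ.faces ∨ F.erase p ∈ B.faces := by
  rw [coneOff, Finset.mem_union, Finset.mem_image]
  constructor
  · rintro (hF | ⟨G, hG, rfl⟩)
    · exact .inl hF
    · exact .inr (B.down_closed hG (Finset.erase_insert_subset p G))
  · rintro (hF | hF)
    · exact .inl hF
    · by_cases hp : p ∈ F
      · exact .inr ⟨F.erase p, hF, Finset.insert_erase hp⟩
      · exact .inl (hB (Finset.erase_eq_of_notMem hp ▸ hF))

theorem singleton_mem_coneOff : {p} ∈ (Δ.coneOff B hB p).faces :=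
  mem_coneOff.2 (.inr (by simpa using B.empty_mem))

theorem deletion_coneOff (hp : {p} ∉ Δ.faces) : (Δ.coneOff B hB p).deletion p = Δ := by
  ext F
  rw [mem_deletion, mem_coneOff]
  constructor
  · rintro ⟨hF | hF, hpF⟩
    · exact hF
    · exact hB (Finset.erase_eq_of_notMem hpF ▸ hF)
  · exact fun hF => ⟨.inl hF, fun hpF => hp (singleton_mem hF hpF)⟩

theorem link_coneOff (hp : {p} ∉ Δ.faces) :
    (Δ.coneOff B hB p).link {p} singleton_mem_coneOff = B := by
  ext F
  rw [mem_link_singleton, mem_coneOff]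
  constructor
  · rintro ⟨hpF, hF | hF⟩
    · exact absurd (singleton_mem hF (Finset.mem_insert_self p F)) hp
    · rwa [Finset.erase_insert hpF] at hF
  · intro hF
    have hpF : p ∉ F := fun hpF => hp (singleton_mem (hB hF) hpF)
    exact ⟨hpF, .inr (by rwa [Finset.erase_insert hpF])⟩

theorem rank_coneOff (hp : {p} ∉ Δ.faces) (hrank : B.rank + 1 = Δ.rank) :
    (Δ.coneOff B hB p).rank = Δ.rank := by
  rw [rank_eq_rank_link_add_one (hv := singleton_mem_coneOff) (by
    rw [deletion_coneOff hp, link_coneOff hp, hrank]), link_coneOff hp, hrank]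

theorem IsFlag.coneOff (hΔ : Δ.IsFlag) (h : B.IsInducedSubcomplex Δ) (hp : {p} ∉ Δ.faces) :
    (Δ.coneOff B h.1 p).IsFlag := by
  intro F hF
  have herase : F.erase p ∈ Δ.faces := by
    refine hΔ _ fun u hu v hv => ?_
    rw [← deletion_coneOff (hB := h.1) hp, mem_deletion]
    rw [Finset.mem_erase] at hu hv
    exact ⟨hF u hu.2 v hv.2, by simp [hu.1.symm, hv.1.symm]⟩
  by_cases hpF : p ∈ F
  · refine mem_coneOff.2 (.inr (h.2 _ herase fun v hv => ?_))
    rw [Finset.mem_erase] at hv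
    rw [← link_coneOff (hB := h.1) hp, singleton_mem_link_singleton]
    exact ⟨hv.1.symm, hF p hpF v hv.2⟩
  · exact mem_coneOff.2 (.inl (Finset.erase_eq_of_notMem hpF ▸ herase))

theorem IsHomologyBall.coneOff {V : Type*} [LinearOrder V] {k : Type*} [Field k]
    {B Δ : FiniteComplex V} {p : V} (h : Δ.IsHomologyBall k B) (hp : {p} ∉ Δ.faces) :
    (Δ.coneOff B h.1 p).IsHomologySphere k :=
  IsHomologyBall.isHomologySphere_of_deletion (hv := singleton_mem_coneOff) <| by
    rwa [deletion_coneOff hp, link_coneOff hp]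

end Cone

section Euler

section

variable {V : Type*} {k : Type*} [Field k]

theorem finite_setOf_mem_faces_card (Δ : FiniteComplex V) (i : ℤ) :
    {F | F ∈ Δ.faces ∧ (F.card : ℤ) = i + 1}.Finite :=
  Δ.faces.finite_toSet.subset fun _ hF => hF.1

instance (Δ : FiniteComplex V) (i : ℤ) : Module.Finite k (Δ.chains k i) := by
  rw [chains, Finsupp.supported_eq_span_single]
  exact Module.Finite.span_of_finite k ((Δ.finite_setOf_mem_faces_card i).image _)

theorem finrank_chains (Δ : FiniteComplex V) (j : ℕ) :
    Module.finrank k (Δ.chains k ((j : ℤ) - 1)) = Δ.faceCount j := by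
  have := (Δ.finite_setOf_mem_faces_card (j - 1)).fintype
  rw [chains, (Finsupp.supportedEquivFinsupp _).finrank_eq, Module.finrank_finsupp_self,
    faceCount, ← Set.toFinset_card]
  congr 1
  ext F
  simp

theorem chains_eq_bot_of_lt_neg_one (Δ : FiniteComplex V) {i : ℤ} (hi : i < -1) :
    Δ.chains k i = ⊥ := by
  refine (Submodule.eq_bot_iff _).2 fun c hc => Finsupp.ext fun F => ?_
  by_contra hF
  have := (mem_chains.1 hc F hF).2
  omega

theorem sum_faceCount {R : Type*} [Semiring R] (Δ : FiniteComplex V) (f : ℕ → R) :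
    ∑ j ∈ Finset.range (Δ.rank + 1), Δ.faceCount j * f j = ∑ F ∈ Δ.faces, f F.card := by
  rw [← Finset.sum_fiberwise_of_maps_to (t := Finset.range (Δ.rank + 1)) (g := Finset.card)
    (fun F hF => Finset.mem_range.2 (Nat.lt_succ_of_le (card_le_rank hF)))]
  refine Finset.sum_congr rfl fun j _ => ?_
  rw [Finset.sum_congr rfl (g := fun _ => f j) (fun F hF => by rw [(Finset.mem_filter.1 hF).2]),
    Finset.sum_const, nsmul_eq_mul, faceCount]

theorem sum_filter_subset_eq_sum_link [DecidableEq V] {M : Type*} [AddCommMonoid M]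
    {Δ : FiniteComplex V} {F : Finset V} (hF : F ∈ Δ.faces) (f : Finset V → M) :
    ∑ G ∈ Δ.faces with F ⊆ G, f G = ∑ G ∈ (Δ.link F hF).faces, f (F ∪ G) := by
  refine Finset.sum_nbij' (· \ F) (F ∪ ·) ?_ ?_ ?_ ?_ ?_
  · intro G hG
    obtain ⟨hG, hFG⟩ := Finset.mem_filter.1 hG
    exact mem_link.2 ⟨Finset.disjoint_sdiff, by rwa [Finset.union_sdiff_of_subset hFG]⟩
  · exact fun G hG => Finset.mem_filter.2 ⟨(mem_link.1 hG).2, Finset.subset_union_left⟩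
  · exact fun G hG => Finset.union_sdiff_of_subset (Finset.mem_filter.1 hG).2
  · exact fun G hG => Finset.union_sdiff_cancel_left (mem_link.1 hG).1
  · exact fun G hG => by rw [Finset.union_sdiff_of_subset (Finset.mem_filter.1 hG).2]

end

variable {V : Type*} [LinearOrder V] {k : Type*} [Field k] {Δ : FiniteComplex V} {F : Finset V}

instance (Δ : FiniteComplex V) (i : ℤ) : Module.Finite k (Δ.cycles k i) :=
  Submodule.finiteDimensional_of_le (inf_le_left : _ ≤ Δ.chains k i)

theorem finrank_chains_add_one (Δ : FiniteComplex V) (i : ℤ) :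
    Module.finrank k (Δ.chains k (i + 1)) =
      Module.finrank k (Δ.cycles k (i + 1)) + Module.finrank k (Δ.boundaries k i) := by
  have hrange : LinearMap.range (boundary k ∘ₗ (Δ.chains k (i + 1)).subtype) =
      Δ.boundaries k i := by
    rw [LinearMap.range_comp, Submodule.range_subtype, boundaries]
  have hker : (LinearMap.ker (boundary k ∘ₗ (Δ.chains k (i + 1)).subtype)).map
      (Δ.chains k (i + 1)).subtype = Δ.cycles k (i + 1) := by
    rw [LinearMap.ker_comp, Submodule.map_comap_subtype, cycles]
  rw [← hrange, ← hker, Submodule.finrank_map_subtype_eq, Nat.add_comm]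
  exact (LinearMap.finrank_range_add_finrank_ker _).symm

theorem finrank_reducedHomology_add (Δ : FiniteComplex V) (i : ℤ) :
    Module.finrank k (Δ.ReducedHomology k i) + Module.finrank k (Δ.boundaries k i) =
      Module.finrank k (Δ.cycles k i) := by
  rw [← (Submodule.submoduleOfEquivOfLe (Δ.boundaries_le_cycles k i)).finrank_eq]
  exact Submodule.finrank_quotient_add_finrank _

variable (k) in
theorem sum_neg_one_pow_card_eq_sum_finrank (Δ : FiniteComplex V) :
    ∑ F ∈ Δ.faces, (-1 : ℤ) ^ F.card =
      ∑ j ∈ Finset.range (Δ.rank + 1),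
        Module.finrank k (Δ.ReducedHomology k ((j : ℤ) - 1)) * (-1 : ℤ) ^ j := by
  rw [← sum_faceCount, ← sub_eq_zero, ← Finset.sum_sub_distrib]
  let b (j : ℕ) : ℤ := (-1) ^ j * Module.finrank k (Δ.boundaries k ((j : ℤ) - 2))
  have htelescope (j : ℕ) : (Δ.faceCount j : ℤ) * (-1) ^ j -
      Module.finrank k (Δ.ReducedHomology k ((j : ℤ) - 1)) * (-1) ^ j = b j - b (j + 1) := by
    have hchains := Δ.finrank_chains_add_one (k := k) ((j : ℤ) - 2)
    have hhomology := Δ.finrank_reducedHomology_add (k := k) ((j : ℤ) - 1)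
    have hindex : ((j + 1 : ℕ) : ℤ) - 2 = j - 1 := by
      push_cast
      ring
    rw [show (j : ℤ) - 2 + 1 = j - 1 by ring, finrank_chains] at hchains
    dsimp only [b]
    rw [hindex, hchains, ← hhomology]
    push_cast
    ring
  have hb_zero : b 0 = 0 := by
    have hbot : Δ.boundaries k ((0 : ℕ) - 2) = ⊥ :=
      le_bot_iff.1 <| (Δ.boundaries_le_cycles k _).trans <|
        inf_le_left.trans (Δ.chains_eq_bot_of_lt_neg_one (by norm_num)).le
    dsimp only [b]
    rw [hbot, finrank_bot, Nat.cast_zero, mul_zero]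
  have hb_top : b (Δ.rank + 1) = 0 := by
    have htop : ((Δ.rank + 1 : ℕ) : ℤ) - 2 = Δ.dim := by
      rw [dim]
      push_cast
      ring
    dsimp only [b]
    rw [htop, boundaries_dim_eq_bot, finrank_bot, Nat.cast_zero, mul_zero]
  rw [Finset.sum_congr rfl fun j _ => htelescope j, Finset.sum_range_sub', hb_zero, hb_top,
    sub_zero]

theorem HasSphereHomology.sum_neg_one_pow_card (h : Δ.HasSphereHomology k) :
    ∑ F ∈ Δ.faces, (-1 : ℤ) ^ F.card = (-1) ^ Δ.rank := by
  rw [sum_neg_one_pow_card_eq_sum_finrank k, Finset.sum_eq_single Δ.rank]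
  · obtain ⟨e⟩ := (h Δ.dim).1 rfl
    rw [← dim, e.finrank_eq, Module.finrank_self, Nat.cast_one, one_mul]
  · intro j _ hj
    have := (h (j - 1)).2 (by rw [dim]; omega)
    rw [Module.finrank_zero_of_subsingleton, Nat.cast_zero, zero_mul]
  · exact fun h => absurd (Finset.self_mem_range_succ Δ.rank) h

theorem IsHomologySphere.sum_neg_one_pow_card_superset (h : Δ.IsHomologySphere k)
    (hF : F ∈ Δ.faces) : ∑ G ∈ Δ.faces with F ⊆ G, (-1 : ℤ) ^ G.card = (-1) ^ Δ.rank := by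
  rw [sum_filter_subset_eq_sum_link hF, ← h.rank_link hF, add_comm, pow_add,
    ← (h.hasSphereHomology_link hF).sum_neg_one_pow_card, Finset.mul_sum]
  refine Finset.sum_congr rfl fun G hG => ?_
  rw [Finset.card_union_of_disjoint (mem_link.1 hG).1, pow_add]

end Euler

end FiniteComplex

section Reflect

variable {R : Type*}

theorem reflect_finset_sum [Semiring R] {ι : Type*} (n : ℕ) (s : Finset ι) (f : ι → R[X]) :
    reflect n (∑ i ∈ s, f i) = ∑ i ∈ s, reflect n (f i) := by
  ext m
  simp only [coeff_reflect, finsetSum_coeff]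

theorem reflect_pow [Semiring R] {p : R[X]} {m : ℕ} (hp : p.natDegree ≤ m) (n : ℕ) :
    reflect (n * m) (p ^ n) = reflect m p ^ n := by
  induction n with
  | zero => rw [Nat.zero_mul, pow_zero, pow_zero, reflect_one, pow_zero]
  | succ n ih =>
    rw [Nat.succ_mul, pow_succ, reflect_mul _ _ (natDegree_pow_le_of_le n hp) hp, ih, pow_succ]

theorem reflect_one_add_X_pow [Semiring R] (n : ℕ) :
    reflect n ((1 + X : R[X]) ^ n) = (1 + X) ^ n := by
  have hpow := reflect_pow (R := R) (p := 1 + X) (m := 1) (by compute_degree) n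
  rwa [mul_one, reflect_add, reflect_one, pow_one, reflect_one_X, add_comm X] at hpow

theorem reflect_one_sub_X_pow [Ring R] (n : ℕ) :
    reflect n ((1 - X : R[X]) ^ n) = (X - 1) ^ n := by
  have hpow := reflect_pow (R := R) (p := 1 - X) (m := 1) (by compute_degree) n
  rwa [mul_one, reflect_sub, reflect_one, pow_one, reflect_one_X] at hpow

theorem reflect_X_pow_mul_one_sub_X_pow [Ring R] {m n : ℕ} (h : m ≤ n) :
    reflect n ((X : R[X]) ^ m * (1 - X) ^ (n - m)) = (X - 1) ^ (n - m) := by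
  obtain ⟨d, rfl⟩ := Nat.exists_eq_add_of_le h
  have hdeg : ((1 - X : R[X]) ^ d).natDegree ≤ d := by compute_degree
  rw [Nat.add_sub_cancel_left, reflect_mul _ _ (natDegree_X_pow_le m) hdeg, reflect_one_sub_X_pow,
    reflect_monomial, revAt_le le_rfl, Nat.sub_self, pow_zero, one_mul]

end Reflect

section Gamma

theorem exists_eq_X_mul_of_reflect_eq_self {R : Type*} [Semiring R] {n : ℕ} {p : R[X]}
    (hdeg : p.natDegree ≤ n + 2) (hp : reflect (n + 2) p = p) (h0 : p.coeff 0 = 0) :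
    ∃ q, p = X * q ∧ q.natDegree ≤ n ∧ reflect n q = q := by
  obtain ⟨q, rfl⟩ := X_dvd_iff.2 h0
  have hqdeg : q.natDegree ≤ n := by
    refine natDegree_le_iff_coeff_eq_zero.2 fun m hm => ?_
    rw [← coeff_X_mul]
    obtain hm | rfl : n + 2 < m + 1 ∨ m = n + 1 := by omega
    · exact coeff_eq_zero_of_natDegree_lt (hdeg.trans_lt hm)
    · rw [← hp, coeff_reflect, revAt_le le_rfl, Nat.sub_self, h0]
  have hX : reflect 2 (X : R[X]) = X := by
    have hmonomial := reflect_monomial (R := R) 2 1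
    rwa [revAt_le one_le_two, pow_one, show 2 - 1 = 1 from rfl, pow_one] at hmonomial
  rw [add_comm, reflect_mul _ _ (natDegree_X_le.trans one_le_two) hqdeg, hX] at hp
  refine ⟨q, rfl, hqdeg, Polynomial.ext fun m => ?_⟩
  rw [← coeff_X_mul, hp, coeff_X_mul]

variable {n : ℕ} {p q g g' : ℝ[X]}

theorem isGammaPolynomial_C (a : ℝ) (hn : n < 2) :
    IsGammaPolynomial n (C a * (1 + X) ^ n) (C a) := by
  refine ⟨by simp only [natDegree_C, Nat.zero_le], ?_⟩
  rw [Nat.div_eq_of_lt hn, Finset.sum_range_one, coeff_C_zero, pow_zero, mul_one, Nat.mul_zero,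
    Nat.sub_zero]

theorem IsGammaPolynomial.C_add_X_mul (h : IsGammaPolynomial n p g) (a : ℝ) :
    IsGammaPolynomial (n + 2) (C a * (1 + X) ^ (n + 2) + X * p) (C a + X * g) := by
  obtain ⟨hdeg, rfl⟩ := h
  have hhalf : (n + 2) / 2 = n / 2 + 1 := by omega
  refine ⟨natDegree_add_le_of_degree_le (by simp only [natDegree_C, Nat.zero_le]) ?_, ?_⟩
  · rw [hhalf, add_comm]
    exact natDegree_mul_le_of_le natDegree_X_le hdeg
  · rw [hhalf, Finset.sum_range_succ' _ (n / 2 + 1), Finset.mul_sum, add_comm]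
    congr 1
    · refine Finset.sum_congr rfl fun i _ => ?_
      rw [coeff_add, coeff_C_succ, zero_add, coeff_X_mul,
        show n + 2 - 2 * (i + 1) = n - 2 * i by omega]
      ring
    · rw [coeff_add, coeff_C_zero, coeff_X_mul_zero, add_zero, pow_zero, mul_one, Nat.mul_zero,
        Nat.sub_zero]

theorem exists_isGammaPolynomial (hdeg : p.natDegree ≤ n) (hp : reflect n p = p) :
    ∃ g, IsGammaPolynomial n p g := by
  induction n using Nat.twoStepInduction generalizing p with
  | zero =>
    rw [eq_C_of_natDegree_le_zero hdeg, ← mul_one (C _), ← pow_zero (1 + X)]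
    exact ⟨_, isGammaPolynomial_C _ zero_lt_two⟩
  | one =>
    have hcoeff : p.coeff 1 = p.coeff 0 := by
      conv_lhs => rw [← hp, coeff_reflect, revAt_le le_rfl, Nat.sub_self]
    have hpeq : p = C (p.coeff 0) * (1 + X) ^ 1 := by
      conv_lhs => rw [eq_X_add_C_of_natDegree_le_one hdeg, hcoeff]
      ring
    rw [hpeq]
    exact ⟨_, isGammaPolynomial_C _ one_lt_two⟩
  | more n ih _ =>
    have hpow : ((1 + X : ℝ[X]) ^ (n + 2)).natDegree ≤ n + 2 := by compute_degree
    obtain ⟨r, hr, hrdeg, hrreflect⟩ :=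
      exists_eq_X_mul_of_reflect_eq_self (p := p - C (p.coeff 0) * (1 + X) ^ (n + 2))
        ((natDegree_sub_le_of_le hdeg ((natDegree_C_mul_le _ _).trans hpow)).trans_eq (max_self _))
        (by rw [reflect_sub, reflect_C_mul, reflect_one_add_X_pow, hp])
        (by simp only [coeff_zero_eq_eval_zero, eval_sub, eval_mul, eval_C, eval_pow, eval_add,
          eval_one, eval_X, add_zero, one_pow, mul_one, sub_self])
    obtain ⟨g, hg⟩ := ih hrdeg hrreflect
    rw [eq_add_of_sub_eq' hr]
    exact ⟨_, hg.C_add_X_mul _⟩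

theorem IsGammaPolynomial.add (hp : IsGammaPolynomial n p g) (hq : IsGammaPolynomial n q g') :
    IsGammaPolynomial n (p + q) (g + g') := by
  refine ⟨natDegree_add_le_of_degree_le hp.1 hq.1, ?_⟩
  simp only [coeff_add, C_add, add_mul, Finset.sum_add_distrib, ← hp.2, ← hq.2]

theorem IsGammaPolynomial.sub (hp : IsGammaPolynomial n p g) (hq : IsGammaPolynomial n q g') :
    IsGammaPolynomial n (p - q) (g - g') := by
  refine ⟨(natDegree_sub_le_of_le hp.1 hq.1).trans_eq (max_self _), ?_⟩
  simp only [coeff_sub, C_sub, sub_mul, Finset.sum_sub_distrib, ← hp.2, ← hq.2]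

theorem IsGammaPolynomial.one_add_X_mul (h : IsGammaPolynomial n p g) :
    IsGammaPolynomial (n + 1) ((1 + X) * p) g := by
  refine ⟨h.1.trans (by omega), ?_⟩
  rw [← Finset.sum_subset (Finset.range_mono (show n / 2 + 1 ≤ (n + 1) / 2 + 1 by omega))]
  · conv_lhs => rw [h.2, Finset.mul_sum]
    refine Finset.sum_congr rfl fun i hi => ?_
    rw [Finset.mem_range] at hi
    rw [show n + 1 - 2 * i = n - 2 * i + 1 by omega, pow_succ]
    ring
  · intro i _ hi
    rw [Finset.mem_range, Nat.lt_succ_iff, not_le] at hi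
    rw [coeff_eq_zero_of_natDegree_lt (h.1.trans_lt hi), C_0, zero_mul, zero_mul]

theorem isGammaPositive_iff_exists_isGammaPolynomial :
    IsGammaPositive n p ↔ ∃ g, IsGammaPolynomial n p g ∧ ∀ i, 0 ≤ g.coeff i := by
  refine ⟨fun ⟨γ, hγ, hp⟩ => ?_, fun ⟨g, hg, hpos⟩ => ⟨g.coeff, hpos, hg.2⟩⟩
  have hcoeff (i : ℕ) : (∑ j ∈ Finset.range (n / 2 + 1), monomial j (γ j)).coeff i =
      if i ∈ Finset.range (n / 2 + 1) then γ i else 0 := by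
    simp only [finsetSum_coeff, coeff_monomial, Finset.sum_ite_eq']
  refine ⟨∑ j ∈ Finset.range (n / 2 + 1), monomial j (γ j), ⟨?_, ?_⟩, fun i => ?_⟩
  · refine natDegree_sum_le_of_forall_le _ _ fun j hj => (natDegree_monomial_le _).trans ?_
    exact Nat.lt_succ_iff.1 (Finset.mem_range.1 hj)
  · exact hp.trans (Finset.sum_congr rfl fun i hi => by rw [hcoeff, if_pos hi])
  · rw [hcoeff]
    split_ifs
    exacts [hγ i, le_rfl]

theorem IsGammaPositive.add (hp : IsGammaPositive n p) (hq : IsGammaPositive n q) :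
    IsGammaPositive n (p + q) := by
  obtain ⟨γ, hγ, rfl⟩ := hp
  obtain ⟨δ, hδ, rfl⟩ := hq
  refine ⟨γ + δ, fun i => add_nonneg (hγ i) (hδ i), ?_⟩
  simp only [Pi.add_apply, C_add, add_mul, Finset.sum_add_distrib]

end Gamma

namespace FiniteComplex

section DehnSommerville

variable {V : Type*}

theorem hPoly_eq_sum (Δ : FiniteComplex V) :
    Δ.hPoly = ∑ F ∈ Δ.faces, X ^ F.card * (1 - X) ^ (Δ.rank - F.card) := by
  simp only [← Δ.sum_faceCount fun j => X ^ j * (1 - X : ℝ[X]) ^ (Δ.rank - j), hPoly, mul_assoc,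
    map_natCast]

-- Expand `x ^ |G| = ∑ F ⊆ G, (x - 1) ^ (|G| - |F|)` and exchange the summations.
theorem hPoly_eq_sum_mul_sub_one_pow [DecidableEq V] (Δ : FiniteComplex V) :
    Δ.hPoly = ∑ F ∈ Δ.faces, (∑ G ∈ Δ.faces with F ⊆ G, (-1) ^ (Δ.rank - G.card)) *
      (X - 1) ^ (Δ.rank - F.card) := by
  have hexpand (G : Finset V) (hG : G ∈ Δ.faces) :
      (X : ℝ[X]) ^ G.card * (1 - X) ^ (Δ.rank - G.card) =
        ∑ F ∈ G.powerset, (-1) ^ (Δ.rank - G.card) * (X - 1) ^ (Δ.rank - F.card) := by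
    have hpow : (X : ℝ[X]) ^ G.card = ∑ F ∈ G.powerset, (X - 1) ^ (G.card - F.card) := by
      have hbinomial := Finset.sum_pow_mul_eq_add_pow 1 (X - 1 : ℝ[X]) G
      rw [add_sub_cancel] at hbinomial
      simp only [← hbinomial, one_pow, one_mul]
    rw [hpow, ← neg_sub X 1, neg_pow, Finset.sum_mul]
    refine Finset.sum_congr rfl fun F hF => ?_
    have hFG := Finset.card_le_card (Finset.mem_powerset.1 hF)
    have hGr := card_le_rank hG
    rw [show Δ.rank - F.card = G.card - F.card + (Δ.rank - G.card) by omega, pow_add]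
    ring
  rw [hPoly_eq_sum, Finset.sum_congr rfl hexpand]
  simp only [Finset.sum_mul]
  refine Finset.sum_comm' fun G F => ?_
  rw [Finset.mem_filter, Finset.mem_powerset]
  exact ⟨fun h => ⟨h, Δ.down_closed h.1 h.2⟩, fun h => h.1⟩

variable [LinearOrder V] {k : Type*} [Field k] {Δ : FiniteComplex V}

theorem IsHomologySphere.hPoly_eq_sum_sub_one_pow (h : Δ.IsHomologySphere k) :
    Δ.hPoly = ∑ F ∈ Δ.faces, (X - 1) ^ (Δ.rank - F.card) := by
  rw [hPoly_eq_sum_mul_sub_one_pow]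
  refine Finset.sum_congr rfl fun F hF => ?_
  have hsign (G : Finset V) (hG : G ∈ {G ∈ Δ.faces | F ⊆ G}) :
      (-1 : ℤ) ^ (Δ.rank - G.card) = (-1) ^ Δ.rank * (-1) ^ G.card := by
    rw [← pow_sub_mul_pow (-1 : ℤ) (card_le_rank (Finset.mem_filter.1 hG).1), mul_assoc, ← mul_pow,
      neg_mul_neg, one_mul, one_pow, mul_one]
  have hsum : ∑ G ∈ Δ.faces with F ⊆ G, (-1 : ℤ) ^ (Δ.rank - G.card) = 1 := by
    rw [Finset.sum_congr rfl hsign, ← Finset.mul_sum, h.sum_neg_one_pow_card_superset hF, ← mul_pow,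
      neg_mul_neg, one_mul, one_pow]
  have hsum_cast := congrArg (Int.cast : ℤ → ℝ[X]) hsum
  push_cast at hsum_cast
  rw [hsum_cast, one_mul]

theorem IsHomologySphere.natDegree_hPoly_le (h : Δ.IsHomologySphere k) :
    Δ.hPoly.natDegree ≤ Δ.rank := by
  rw [h.hPoly_eq_sum_sub_one_pow]
  refine natDegree_sum_le_of_forall_le _ _ fun F _ => ?_
  have hdeg : (X - 1 : ℝ[X]).natDegree ≤ 1 := by compute_degree
  simpa only [mul_one] using natDegree_pow_le_of_le (Δ.rank - F.card) hdeg |>.trans (by omega)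

theorem IsHomologySphere.reflect_hPoly (h : Δ.IsHomologySphere k) :
    reflect Δ.rank Δ.hPoly = Δ.hPoly := by
  conv_rhs => rw [h.hPoly_eq_sum_sub_one_pow]
  rw [hPoly_eq_sum, reflect_finset_sum]
  exact Finset.sum_congr rfl fun F hF => reflect_X_pow_mul_one_sub_X_pow (card_le_rank hF)

end DehnSommerville

section HPolynomials

variable {V : Type*}

theorem one_sub_X_mul_hPoly (Δ : FiniteComplex V) :
    (1 - X) * Δ.hPoly = ∑ F ∈ Δ.faces, X ^ F.card * (1 - X) ^ (Δ.rank + 1 - F.card) := by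
  rw [hPoly_eq_sum, Finset.mul_sum]
  refine Finset.sum_congr rfl fun F hF => ?_
  rw [Nat.sub_add_comm (card_le_rank hF), pow_succ]
  ring

variable [DecidableEq V] {Δ Δ₁ Δ₂ Γ : FiniteComplex V} {v : V}

theorem IsDecomposition.thetaPoly_add_thetaPoly (h : IsDecomposition Δ Δ₁ Δ₂ Γ)
    (h₁ : Δ₁.rank = Δ.rank) (h₂ : Δ₂.rank = Δ.rank) (hΓ : Γ.rank + 1 = Δ.rank) :
    Δ₁.thetaPoly Γ + Δ₂.thetaPoly Γ = Δ.hPoly - (1 + X) * Γ.hPoly := by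
  have hunion := Finset.sum_union_inter (s₁ := Δ₁.faces) (s₂ := Δ₂.faces)
    (f := fun F => X ^ F.card * (1 - X : ℝ[X]) ^ (Δ.rank - F.card))
  rw [← h.union, ← h.inter, ← hPoly_eq_sum, ← hΓ, ← one_sub_X_mul_hPoly, hΓ] at hunion
  rw [thetaPoly, thetaPoly, Δ₁.hPoly_eq_sum, Δ₂.hPoly_eq_sum, h₁, h₂]
  linear_combination -hunion

theorem hPoly_eq_hPoly_deletion_add (hv : {v} ∈ Δ.faces)
    (hrank : (Δ.deletion v).rank = (Δ.link {v} hv).rank + 1) :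
    Δ.hPoly = (Δ.deletion v).hPoly + X * (Δ.link {v} hv).hPoly := by
  have hΔ : Δ.rank = (Δ.link {v} hv).rank + 1 := rank_eq_rank_link_add_one hrank.le
  have hlink : ∑ F ∈ Δ.faces with {v} ⊆ F, X ^ F.card * (1 - X : ℝ[X]) ^ (Δ.rank - F.card) =
      X * (Δ.link {v} hv).hPoly := by
    rw [sum_filter_subset_eq_sum_link hv, hPoly_eq_sum, Finset.mul_sum, hΔ]
    refine Finset.sum_congr rfl fun G hG => ?_
    rw [Finset.card_union_of_disjoint (mem_link.1 hG).1, Finset.card_singleton, add_comm 1,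
      Nat.add_sub_add_right, pow_succ]
    ring
  have hdeletion : {F ∈ Δ.faces | ¬{v} ⊆ F} = (Δ.deletion v).faces := by
    ext F
    rw [Finset.mem_filter, mem_deletion, Finset.singleton_subset_iff]
  rw [hPoly_eq_sum, ← Finset.sum_filter_add_sum_filter_not _ ({v} ⊆ ·), hlink, add_comm,
    hdeletion, hPoly_eq_sum (Δ.deletion v), hrank, hΔ]

theorem thetaPoly_deletion_link (hv : {v} ∈ Δ.faces)
    (hrank : (Δ.deletion v).rank = (Δ.link {v} hv).rank + 1) :
    (Δ.deletion v).thetaPoly (Δ.link {v} hv) = Δ.hPoly - (1 + X) * (Δ.link {v} hv).hPoly := by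
  rw [thetaPoly, hPoly_eq_hPoly_deletion_add hv hrank]
  ring

end HPolynomials

section GammaInequalities

theorem IsHomologySphere.exists_isGammaPolynomial {V : Type*} [LinearOrder V] {k : Type*} [Field k]
    {Δ : FiniteComplex V} (h : Δ.IsHomologySphere k) :
    ∃ g, IsGammaPolynomial Δ.rank Δ.hPoly g :=
  _root_.exists_isGammaPolynomial h.natDegree_hPoly_le h.reflect_hPoly

variable {V : Type*} [DecidableEq V] {Δ Γ : FiniteComplex V}

theorem gammaLE_iff_isGammaPositive (hΓ : ∃ g, IsGammaPolynomial Γ.rank Γ.hPoly g)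
    (hrank : Γ.rank + 1 = Δ.rank) :
    GammaLE Γ Δ ↔ IsGammaPositive Δ.rank (Δ.hPoly - (1 + X) * Γ.hPoly) := by
  rw [isGammaPositive_iff_exists_isGammaPolynomial]
  constructor
  · rintro ⟨g, g', hg, hg', hle⟩
    refine ⟨g' - g, hg'.sub (hrank ▸ hg.one_add_X_mul), fun i => ?_⟩
    rw [coeff_sub]
    exact sub_nonneg.2 (hle i)
  · rintro ⟨d, hd, hpos⟩
    obtain ⟨g, hg⟩ := hΓ
    refine ⟨g, d + g, hg, ?_, fun i => ?_⟩
    · rw [← sub_add_cancel Δ.hPoly ((1 + X) * Γ.hPoly)]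
      exact hd.add (hrank ▸ hg.one_add_X_mul)
    · rw [coeff_add]
      exact le_add_of_nonneg_left (hpos i)

theorem IsHomologySphere.exists_isHomologyBall_restrict {V : Type*} [LinearOrder V] {k : Type*}
    [Field k] {Δ Γ : FiniteComplex V} (hΔ : Δ.IsHomologySphere k) (hΓ : Γ.IsHomologySphere k)
    (hrank : Γ.rank + 1 = Δ.rank) (hΓΔ : Γ.IsInducedSubcomplex Δ) :
    ∃ S₁ S₂ : Set V,
      (Δ.restrict S₁).IsHomologyBall k Γ ∧ (Δ.restrict S₂).IsHomologyBall k Γ ∧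
        (Δ.restrict S₁).thetaPoly Γ + (Δ.restrict S₂).thetaPoly Γ =
          Δ.hPoly - (1 + X) * Γ.hPoly := by
  obtain ⟨S₁, S₂, h⟩ := hΔ.exists_isDecomposition_restrict hΓ hrank hΓΔ
  exact ⟨S₁, S₂, h.isHomologyBall_left hΔ hΓ hrank, h.symm.isHomologyBall_left hΔ hΓ hrank,
    h.thetaPoly_add_thetaPoly (h.rank_left hΔ) (h.symm.rank_left hΔ) hrank⟩

theorem IsHomologyBall.gammaLE_coneOff_iff {V : Type*} [LinearOrder V] {k : Type*} [Field k]
    {Δ B : FiniteComplex V} {p : V} (h : Δ.IsHomologyBall k B) (hp : {p} ∉ Δ.faces) :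
    GammaLE B (Δ.coneOff B h.1 p) ↔ IsGammaPositive Δ.rank (Δ.thetaPoly B) := by
  have htheta := thetaPoly_deletion_link (Δ := Δ.coneOff B h.1 p) singleton_mem_coneOff
    (by rw [deletion_coneOff hp, link_coneOff hp, h.rank_add_one])
  rw [deletion_coneOff hp, link_coneOff hp] at htheta
  have hrank := rank_coneOff (hB := h.1) hp h.rank_add_one
  rw [htheta, ← hrank]
  exact gammaLE_iff_isGammaPositive h.2.1.exists_isGammaPolynomial (h.rank_add_one.trans hrank.symm)

end GammaInequalities

section Flag

variable {V : Type*} [DecidableEq V] {Γ Δ : FiniteComplex V} {F : Finset V} {v : V}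

theorem IsFlag.of_isInducedSubcomplex (h : Δ.IsFlag) (hΓ : Γ.IsInducedSubcomplex Δ) :
    Γ.IsFlag := fun F hF =>
  hΓ.2 F (h F fun u hu w hw => hΓ.1 (hF u hu w hw)) fun u hu => by simpa using hF u hu u hu

theorem IsFlag.insert_mem (h : Δ.IsFlag) (hv : {v} ∈ Δ.faces) (hF : F ∈ Δ.faces)
    (hvF : ∀ u ∈ F, {v, u} ∈ Δ.faces) : insert v F ∈ Δ.faces := by
  refine h _ fun u hu w hw => ?_
  obtain rfl | huF := Finset.mem_insert.1 hu <;> obtain rfl | hwF := Finset.mem_insert.1 hw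
  · simpa using hv
  · exact hvF w hwF
  · rw [Finset.pair_comm]
    exact hvF u huF
  · exact Δ.down_closed hF (Finset.insert_subset huF (Finset.singleton_subset_iff.2 hwF))

theorem IsFlag.isInducedSubcomplex_link_singleton (h : Δ.IsFlag) (hv : {v} ∈ Δ.faces) :
    (Δ.link {v} hv).IsInducedSubcomplex Δ := by
  refine ⟨link_subset hv, fun F hF hlink => mem_link_singleton.2 ⟨fun hvF => ?_, ?_⟩⟩
  · exact (singleton_mem_link_singleton.1 (hlink v hvF)).1 rfl
  · exact h.insert_mem hv hF fun u hu => (singleton_mem_link_singleton.1 (hlink u hu)).2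

end Flag

end FiniteComplex

theorem mainTheorem12 (k : Type*) [Field k] (n : ℕ) (hn : 0 < n) :
    List.TFAE [
      ∀ (V : Type u) [LinearOrder V] (Δ B : FiniteComplex V),
        Δ.IsFlag → Δ.IsHomologyBall k B → Δ.dim = (n : ℤ) - 1 → B.IsInducedSubcomplex Δ →
          IsGammaPositive n (Δ.thetaPoly B),
      ∀ (V : Type u) [LinearOrder V] (Δ : FiniteComplex V),
        Δ.IsFlag → Δ.IsHomologySphere k → Δ.dim = (n : ℤ) - 1 →
          ∀ (v : V) (hv : {v} ∈ Δ.faces), GammaLE (Δ.link {v} hv) Δ,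
      ∀ (V : Type u) [LinearOrder V] (Δ Γ : FiniteComplex V),
        Δ.IsFlag → Δ.IsHomologySphere k → Δ.dim = (n : ℤ) - 1 →
          Γ.IsFlag → Γ.IsHomologySphere k → Γ.dim = (n : ℤ) - 2 → Γ.IsInducedSubcomplex Δ →
            GammaLE Γ Δ] := by
  tfae_have 1 → 3 := fun h V _ Δ Γ hΔ_flag hΔ hΔ_dim _ hΓ hΓ_dim hΓΔ => by
    obtain rfl := FiniteComplex.dim_eq_natCast_sub_one_iff.1 hΔ_dim
    have hrank : Γ.rank + 1 = Δ.rank := FiniteComplex.dim_add_one_eq_dim_iff.1 (by omega)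
    have htheta (S : Set V) (hball : (Δ.restrict S).IsHomologyBall k Γ) :
        IsGammaPositive Δ.rank ((Δ.restrict S).thetaPoly Γ) :=
      have hS := Δ.isInducedSubcomplex_restrict S
      h V _ Γ (hΔ_flag.of_isInducedSubcomplex hS) hball (by have := hball.2.2.1; omega)
        (hΓΔ.mono hball.1 hS.1)
    obtain ⟨S₁, S₂, h₁, h₂, hadd⟩ := hΔ.exists_isHomologyBall_restrict hΓ hrank hΓΔ
    rw [FiniteComplex.gammaLE_iff_isGammaPositive hΓ.exists_isGammaPolynomial hrank, ← hadd]
    exact (htheta S₁ h₁).add (htheta S₂ h₂)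
  tfae_have 3 → 2 := fun h V _ Δ hΔ_flag hΔ hΔ_dim v hv =>
    have hlink := hΔ_flag.isInducedSubcomplex_link_singleton hv
    h V Δ _ hΔ_flag hΔ hΔ_dim (hΔ_flag.of_isInducedSubcomplex hlink) (hΔ.link hv)
      (by have := hΔ.dim_link_singleton hv; omega) hlink
  tfae_have 2 → 1 := fun h V _ Δ B hΔ_flag hΔ hΔ_dim hBΔ => by
    obtain rfl := FiniteComplex.dim_eq_natCast_sub_one_iff.1 hΔ_dim
    have hball := hΔ.map WithBot.coeOrderHom
    have hbot := Δ.singleton_notMem_map (f := WithBot.coeOrderHom.toEmbedding) (w := ⊥) (by simp)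
    have hle := h (WithBot V) _ ((hΔ_flag.map _).coneOff (hBΔ.map _) hbot) (hball.coneOff hbot)
      (by rw [FiniteComplex.dim, FiniteComplex.rank_coneOff hbot hball.rank_add_one,
        FiniteComplex.rank_map]) ⊥ FiniteComplex.singleton_mem_coneOff
    rwa [FiniteComplex.link_coneOff hbot, hball.gammaLE_coneOff_iff hbot,
      FiniteComplex.thetaPoly_map, FiniteComplex.rank_map] at hle
  tfae_finish
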